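/- Let $\mathcal X,\mathcal Y$ be finite alphabets, $P_{Y|X}$ a channel from $\mathcal X$ to $\mathcal Y$ and $Q_Y$ a distribution on $\mathcal Y$ such that the set $\mathcal P(P_{Y|X},Q_Y)$ of input distributions $P_X$ with $\sum_x P_X(x)P_{Y|X}(\cdot|x)=Q_Y$ is non-empty. For distributions $P,Q$ on a finite set let $D_1(P\|Q)=\sum_x P(x)\log\frac{P(x)}{Q(x)}$ and $D_{1+s}(P\|Q)=\frac1s\log\sum_x P(x)^{1+s}Q(x)^{-s}$ for $s\ge -1$, $s\ne0$, with values in $[0,\infty]$, natural logarithms and the usual conventions; for $s=-1$ the formula is read with $0^0=1$. A random code of rate $R>0$ and blocklength $n$ consists of a message uniform on $\{1,\dots,M\}$, $M=\lceil e^{nR}\rceil$, an independent random variable $U_n$ on a finite alphabet and, for each value $u$ of $U_n$, a map $f_u=(f_{u,1},\dots,f_{u,n}):\{1,\dots,M\}\to\mathcal X^n$; the channel output has the law $P_{Y^n|U_n}(y^n|u)=\frac1M\sum_{m=1}^M\prod_{i=1}^nP_{Y|X}(y_i|f_{u,i}(m))$. Let $Q_{Y^n}=Q_Y^n$ be the $n$-fold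 product law. Then the following hold. (1) For every $s\in[-1,1]$, $$\inf\Bigl\{R>0:\ \inf_{f_{U_n}}D_{1+s}(P_{Y^nU_n}\|Q_{Y^n}P_{U_n})\to0\ \text{ as } n\to\infty\Bigr\}=R_{1+s}(P_{Y|X},Q_Y),$$ where the inner infimum is over all random codes of rate $R$ and blocklength $n$, and $$R_{1+s}(P_{Y|X},Q_Y)=\begin{cases}\min_{P_X\in\mathcal P(P_{Y|X},Q_Y)}\sum_xP_X(x)D_{1+s}(P_{Y|X}(\cdot|x)\|Q_Y)&s\in(0,1],\\ \min_{P_X\in\mathcal P(P_{Y|X},Q_Y)}\sum_xP_X(x)D_1(P_{Y|X}(\cdot|x)\|Q_Y)&s\in(-1,0],\\ 0&s=-1,\end{cases}$$ the minima being attained. (2) Let $s\in[-1,1]$. For every $R>R_{1+s}(P_{Y|X},Q_Y)$ there are $P_X\in\mathcal P(P_{Y|X},Q_Y)$ and $\epsilon>0$ such that the typical-set codes satisfy $D_{1+s}(P_{Y^nU_n}\|Q_{Y^n}P_{U_n})\to0$. Here the codewords of the typical-set code are drawn independently from $P_X^n$ conditioned on the set of all $x^n$ whose empirical distribution $T_{x^n}$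 satisfies $|T_{x^n}(a)-P_X(a)|\le\epsilon P_X(a)$ for all $a\in\mathcal X$ (a set of positive probability for all large $n$; for the other $n$ the codewords are drawn from $P_X^n$). (3) If $D_0$ is instead defined by $D_0(P\|Q)=-\log Q(\{P>0\})$, then the infimum of the rates $R>0$ with $\inf_{f_{U_n}}D_0(P_{Y^nU_n}\|Q_{Y^n}P_{U_n})\to0$ equals $0$ if and only if some $x\in\mathcal X$ satisfies $P_{Y|X}(y|x)>0$ for all $y$ with $Q_Y(y)>0$. -/

import Mathlib

open Filter Topology
open scoped ENNReal

noncomputable section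

namespace RenyiResolvability

universe u v

/-- Rényi divergence `D_{1+s}(P‖Q)` (natural logarithm) of two distributions on a finite alphabet,
with values in `[-∞, ∞]`: `∑ P log (P / Q)` for `s = 0`, and
`(1 / s) log ∑ P ^ (1 + s) Q ^ (-s)` for `s ≠ 0`.
The arithmetic of `ℝ≥0∞` and `EReal` supplies the usual conventions: a letter with `P a = 0`
contributes `0` when `s > -1`; a letter with `P a > 0 = Q a` makes the divergence `∞` when `s ≥ 0`
and contributes `0` when `s < 0`; and the divergence is `∞` for disjoint supports when
`-1 < s < 0`. For `s = -1` the formula is read with `0 ^ 0 = 1`. -/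
def renyiDiv {α : Type*} [Fintype α] (s : ℝ) (P Q : PMF α) : EReal :=
  if s = 0 then ∑ a, (P a : EReal) * ENNReal.log (P a / Q a)
  else ((1 / s : ℝ) : EReal) * ENNReal.log (∑ a, P a ^ (1 + s) * Q a ^ (-s))

open Classical in
/-- The order-zero divergence in the support convention, `D_0(P‖Q) = -log Q {P > 0}`, which is the
limit of `D_{1+s}(P‖Q)` as `s` decreases to `-1`. -/
def renyiDivZero {α : Type*} [Fintype α] (P Q : PMF α) : EReal :=
  -ENNReal.log (∑ a, if P a = 0 then 0 else Q a)

/-- The product of the distributions `P i`. -/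
def piLaw {ι : Type*} [Fintype ι] [DecidableEq ι] {α : Type*} [Fintype α] (P : ι → PMF α) :
    PMF (ι → α) :=
  PMF.ofFintype (fun a => ∏ i, P i (a i)) (by
    have h : ∀ i, ∑ b, P i b = 1 := fun i => by
      rw [← tsum_fintype (L := .unconditional _)]; exact (P i).tsum_coe
    have := Finset.prod_univ_sum (fun _ : ι => (Finset.univ : Finset α)) (fun i b => P i b)
    rw [Fintype.piFinset_univ] at this
    rw [← this]
    simp [h])

/-- The product of two distributions. -/
def prodLaw {α β : Type*} [Fintype α] [Fintype β] (P : PMF α) (Q : PMF β) : PMF (α × β) :=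
  PMF.ofFintype (fun p => P p.1 * Q p.2) (by
    have hP : ∑ a, P a = 1 := by
      rw [← tsum_fintype (L := .unconditional _)]; exact P.tsum_coe
    have hQ : ∑ b, Q b = 1 := by
      rw [← tsum_fintype (L := .unconditional _)]; exact Q.tsum_coe
    rw [Fintype.sum_prod_type]
    simp [← Finset.mul_sum, hP, hQ])

/-- The joint distribution of `(Y, U)` when `U` has law `P` and `Y` has conditional law `K u` given
`U = u`. -/
def jointLaw {α β : Type*} [Fintype α] [Fintype β] (P : PMF β) (K : β → PMF α) : PMF (α × β) :=
  PMF.ofFintype (fun p => P p.2 * K p.2 p.1) (by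
    have hP : ∑ b, P b = 1 := by
      rw [← tsum_fintype (L := .unconditional _)]; exact P.tsum_coe
    have hK : ∀ b, ∑ a, K b a = 1 := fun b => by
      rw [← tsum_fintype (L := .unconditional _)]; exact (K b).tsum_coe
    rw [Fintype.sum_prod_type_right]
    simp [← Finset.mul_sum, hP, hK])

/-- The output distribution of `n` uses of the memoryless channel `W` when a message that is
uniform on `M` values is encoded by the codebook `φ`:
`y ↦ (1 / M) ∑ m, ∏ i, W (y i | φ m i)`. -/
def outputLaw {X : Type*} {Y : Type*} [Fintype Y] {M n : ℕ} [NeZero M] (W : X → PMF Y)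
    (φ : Fin M → Fin n → X) : PMF (Fin n → Y) :=
  PMF.ofFintype (fun y => (M : ℝ≥0∞)⁻¹ * ∑ m, ∏ i, W (φ m i) (y i)) (by
    have h : ∀ m, ∑ y : Fin n → Y, ∏ i, W (φ m i) (y i) = 1 := fun m => by
      have := (piLaw (fun i => W (φ m i))).tsum_coe
      rw [tsum_fintype (L := .unconditional _)] at this
      simpa [piLaw] using this
    rw [← Finset.mul_sum, Finset.sum_comm]
    simp only [h, Finset.sum_const, Finset.card_univ, Fintype.card_fin, nsmul_eq_mul, mul_one]
    exact ENNReal.inv_mul_cancel (by exact_mod_cast NeZero.ne M) (ENNReal.natCast_ne_top M))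

/-- A random code with `M` messages and blocklength `n`: a random variable on a finite alphabet
(the common randomness, independent of the message) and, for each of its values, a codebook. -/
structure RandomCode (X : Type u) (M n : ℕ) where
  /-- alphabet of the common randomness -/
  U : Type u
  /-- the alphabet is finite -/
  [finite : Fintype U]
  /-- distribution of the common randomness -/
  law : PMF U
  /-- the codebook selected by each value of the common randomness -/
  map : U → Fin M → Fin n → X

attribute [instance] RandomCode.finite

namespace RandomCode

variable {X : Type u} {Y : Type v} [Fintype Y] {M n : ℕ}

/-- The joint distribution of the channel output and the common randomness. -/
def joint [NeZero M] (c : RandomCode X M n) (W : X → PMF Y) : PMF ((Fin n → Y) × c.U) :=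
  jointLaw c.law (fun u => outputLaw W (c.map u))

/-- The product of the i.i.d. law `Q ^ n` and the law of the common randomness. -/
def target (c : RandomCode X M n) (Q : PMF Y) : PMF ((Fin n → Y) × c.U) :=
  prodLaw (piLaw fun _ => Q) c.law

/-- The conventional random code: the `M` codewords are drawn independently from `P`. -/
def conventional [Fintype X] (M : ℕ) (P : PMF (Fin n → X)) : RandomCode X M n where
  U := Fin M → Fin n → X
  law := piLaw fun _ => P
  map := id

end RandomCode

/-- Number of messages at rate `R` and blocklength `n`: `e ^ (n R)`, rounded up. -/
def numMessages (R : ℝ) (n : ℕ) : ℕ := ⌈Real.exp (n * R)⌉₊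

instance (R : ℝ) (n : ℕ) : NeZero (numMessages R n) :=
  ⟨(Nat.ceil_pos.2 (Real.exp_pos _)).ne'⟩

/-- `inf_{f_U} D_{1+s}(P_{Y^n U_n} ‖ Q^n × P_{U_n})` over all random codes of rate `R` and
blocklength `n`. -/
def optResolvability {X : Type u} {Y : Type v} [Fintype Y] (W : X → PMF Y) (Q : PMF Y)
    (s R : ℝ) (n : ℕ) : EReal :=
  ⨅ c : RandomCode X (numMessages R n) n, renyiDiv s (c.joint W) (c.target Q)

/-- The same infimum for the order-zero divergence in the support convention. -/
def optResolvabilityZero {X : Type u} {Y : Type v} [Fintype Y] (W : X → PMF Y) (Q : PMF Y)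
    (R : ℝ) (n : ℕ) : EReal :=
  ⨅ c : RandomCode X (numMessages R n) n, renyiDivZero (c.joint W) (c.target Q)

/-- The infimum, in the extended reals, of the rates `R > 0` for which `g R n → 0` as `n → ∞`. -/
def infRate (g : ℝ → ℕ → EReal) : EReal :=
  sInf {r : EReal | ∃ R : ℝ, r = R ∧ 0 < R ∧ Tendsto (g R) atTop (𝓝 0)}

/-- The input distributions that induce the output distribution `Q`. -/
def inputs {X : Type u} {Y : Type v} (W : X → PMF Y) (Q : PMF Y) : Set (PMF X) :=
  {P | P.bind W = Q}

/-- `∑ x, P x * D_{1+s}(W x ‖ Q)`. For `s = 0` it is the conditional relative entropy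
`D(W ‖ Q | P)`. -/
def meanDiv {X : Type u} {Y : Type v} [Fintype X] [Fintype Y] (W : X → PMF Y) (Q : PMF Y)
    (s : ℝ) (P : PMF X) : EReal :=
  ∑ x, (P x : EReal) * renyiDiv s (W x) Q

/-- The rate `R_{1+s}(W, Q)`. -/
def rate {X : Type u} {Y : Type v} [Fintype X] [Fintype Y] (W : X → PMF Y) (Q : PMF Y)
    (s : ℝ) : EReal :=
  if s = -1 then 0 else ⨅ P ∈ inputs W Q, meanDiv W Q (max s 0) P

open Classical in
/-- The `ε`-typical set of `P`: the sequences whose empirical distribution `T` satisfies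
`|T a - P a| ≤ ε P a` for all `a`. -/
def typicalSet {X : Type u} (P : PMF X) (ε : ℝ) (n : ℕ) : Set (Fin n → X) :=
  {x | ∀ a, |((Finset.univ.filter fun i => x i = a).card : ℝ) / n - (P a).toReal|
    ≤ ε * (P a).toReal}

open Classical in
/-- The i.i.d. law `P ^ n` conditioned on the `ε`-typical set. When that set has probability zero,
which for `ε > 0` happens for finitely many `n` only, it is `P ^ n` itself. -/
def typicalLaw {X : Type u} [Fintype X] (P : PMF X) (ε : ℝ) (n : ℕ) : PMF (Fin n → X) :=
  if h : ∃ x ∈ typicalSet P ε n, x ∈ (piLaw fun _ : Fin n => P).support then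
    (piLaw fun _ : Fin n => P).filter (typicalSet P ε n) h
  else piLaw fun _ => P

end RenyiResolvability

end

noncomputable section

namespace RenyiResolvability

universe u v

/-! Everything for `s ≠ 0`, `s > -1` is read off the sum `renyiSum`, which is multiplicative over
product laws (`renyiSum_piLaw`) and, for a random code, is the average of the sums of its codebooks
(`renyiSum_joint_target`). Divergences increase with the order, by Jensen.

Achievability for `0 < s ≤ 1`. The `(1+s)`-th moment of an average of `M` independent likelihoods is
at most a self-term `M ^ (-s) * E[w ^ (1+s)]` plus `E[w] ^ (1+s)` (`randomCoding_moment_le`). With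
typical codewords the first term decays exponentially once `R` exceeds the mean row divergence,
because a typical codeword has total row divergence at most about `n` times that mean. The second is
controlled by the output of the typical law, which exceeds `Q ^ n` by at most the factor `1 /
typicalProb`, and this tends to `1`. For `s ≤ 0` one uses a small positive order `t`: the mean
divergence of order `1+t` tends to the conditional relative entropy as `t` tends to `0`
(`exists_sum_rowDiv_lt`), and monotonicity in the order passes convergence down to `s`.

Converse. A small divergence forces the output law close to `Q ^ n` on every event
(`exists_forall_abs_sub_le`). Hence the letter frequencies of the codebook nearly induce `Q`, and
compactness of the simplex shows that they nearly satisfy the lower bound valid for exact inputs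
(`exists_forall_sub_le_sum`). For `s > 0`, superadditivity of `x ^ (1+s)` and Jensen bound the Rényi
sum below by an exponential in this mean divergence, divided by `M ^ s`. For `-1 < s ≤ 0` the event
that some codeword is much likelier than under `Q ^ n` has vanishing target probability when `R` is
too small, while Chebyshev keeps its output probability away from `0`.

At `s = -1` the divergence vanishes identically. In the support convention a row covering the
support of `Q` gives divergence zero when repeated; if there is none, `M` codewords cover an
exponentially small part of `Q ^ n` at small rates. -/

/-! ### Moments over product distributions and the random coding bound. -/

theorem sum_prod_eq_prod_sum {ι α R : Type*} [Fintype ι] [DecidableEq ι] [Fintype α]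
    [CommSemiring R] (f : ι → α → R) : ∑ x : ι → α, ∏ i, f i (x i) = ∏ i, ∑ a, f i a := by
  rw [Finset.prod_univ_sum, Fintype.piFinset_univ]

/-- First moments over a product distribution. -/
theorem sum_prod_mul_apply {ι α R : Type*} [Fintype ι] [DecidableEq ι] [Fintype α]
    [CommSemiring R] (p : ι → α → R) (hp : ∀ i, ∑ a, p i a = 1) (i : ι) (g : α → R) :
    ∑ x : ι → α, (∏ k, p k (x k)) * g (x i) = ∑ a, p i a * g a := by
  have h : ∀ x : ι → α, (∏ k, p k (x k)) * g (x i)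
      = ∏ k, p k (x k) * (if k = i then g (x k) else 1) := fun x => by
    rw [Finset.prod_mul_distrib, Finset.prod_ite_eq' Finset.univ i]; simp
  simp_rw [h]
  rw [sum_prod_eq_prod_sum (fun k a => p k a * (if k = i then g a else 1)),
    Finset.prod_eq_single i]
  · simp
  · intro k _ hk; simp [hk, hp]
  · simp

/-- Second mixed moments over a product distribution. -/
theorem sum_prod_mul_apply_mul_apply {ι α R : Type*} [Fintype ι] [DecidableEq ι] [Fintype α]
    [CommSemiring R] (p : ι → α → R) (hp : ∀ i, ∑ a, p i a = 1) {i j : ι} (hij : i ≠ j)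
    (g h : α → R) :
    ∑ x : ι → α, (∏ k, p k (x k)) * (g (x i) * h (x j))
      = (∑ a, p i a * g a) * ∑ a, p j a * h a := by
  have key : ∀ x : ι → α, (∏ k, p k (x k)) * (g (x i) * h (x j))
      = ∏ k, p k (x k) * ((if k = i then g (x k) else 1) * (if k = j then h (x k) else 1)) :=
    fun x => by
      rw [Finset.prod_mul_distrib, Finset.prod_mul_distrib, Finset.prod_ite_eq' Finset.univ i,
        Finset.prod_ite_eq' Finset.univ j]; simp
  simp_rw [key]
  rw [sum_prod_eq_prod_sum
    (fun k a => p k a * ((if k = i then g a else 1) * (if k = j then h a else 1)))]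
  have : ∀ k, ∑ a, p k a * ((if k = i then g a else 1) * (if k = j then h a else 1))
      = (if k = i then ∑ a, p k a * g a else 1) * (if k = j then ∑ a, p k a * h a else 1) := by
    intro k
    by_cases hi : k = i
    · subst hi; simp [hij]
    · by_cases hj : k = j
      · subst hj; simp [hi]
      · simp [hi, hj, hp]
  simp_rw [this]
  rw [Finset.prod_mul_distrib, Finset.prod_ite_eq' Finset.univ i,
    Finset.prod_ite_eq' Finset.univ j]
  simp

/-- The variance of a sum of independent centred variables. -/
theorem sum_prod_mul_sq_sum {ι α : Type*} [Fintype ι] [DecidableEq ι] [Fintype α]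
    (p : ι → α → ℝ) (hp : ∀ i, ∑ a, p i a = 1) (g : ι → α → ℝ)
    (hg : ∀ i, ∑ a, p i a * g i a = 0) :
    ∑ x : ι → α, (∏ k, p k (x k)) * (∑ i, g i (x i)) ^ 2 = ∑ i, ∑ a, p i a * g i a ^ 2 := by
  have h1 : ∀ x : ι → α, (∏ k, p k (x k)) * (∑ i, g i (x i)) ^ 2
      = ∑ i, ∑ j, (∏ k, p k (x k)) * (g i (x i) * g j (x j)) := fun x => by
    rw [sq, Finset.sum_mul_sum, Finset.mul_sum]
    exact Finset.sum_congr rfl fun i _ => by rw [Finset.mul_sum]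
  simp_rw [h1]
  rw [Finset.sum_comm]
  refine Finset.sum_congr rfl fun i _ => ?_
  rw [Finset.sum_comm, Finset.sum_eq_single i]
  · rw [← sum_prod_mul_apply p hp i fun a => g i a ^ 2]
    exact Finset.sum_congr rfl fun x _ => by rw [sq]
  · intro j _ hj
    rw [sum_prod_mul_apply_mul_apply p hp hj.symm, hg, zero_mul]
  · simp

/-- Chebyshev's inequality for sums of independent variables with a common variance bound. -/
theorem sum_prod_filter_le_of_variance {ι α : Type*} [Fintype ι] [DecidableEq ι] [Fintype α]
    (p : ι → α → ℝ) (hp0 : ∀ i a, 0 ≤ p i a) (hp : ∀ i, ∑ a, p i a = 1) (g : ι → α → ℝ)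
    (hg : ∀ i, ∑ a, p i a * g i a = 0) {V : ℝ} (hV : ∀ i, ∑ a, p i a * g i a ^ 2 ≤ V)
    {t : ℝ} (ht : 0 < t) (S : Finset (ι → α)) (hS : ∀ x ∈ S, t ≤ |∑ i, g i (x i)|) :
    ∑ x ∈ S, ∏ k, p k (x k) ≤ Fintype.card ι * V / t ^ 2 := by
  rw [le_div_iff₀ (by positivity), Finset.sum_mul]
  calc ∑ x ∈ S, (∏ k, p k (x k)) * t ^ 2
      ≤ ∑ x ∈ S, (∏ k, p k (x k)) * (∑ i, g i (x i)) ^ 2 := by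
        refine Finset.sum_le_sum fun x hx => ?_
        have : 0 ≤ ∏ k, p k (x k) := Finset.prod_nonneg fun k _ => hp0 _ _
        have h2 : t ^ 2 ≤ (∑ i, g i (x i)) ^ 2 := by
          rw [← sq_abs (∑ i, g i (x i))]; gcongr; exact hS x hx
        gcongr
    _ ≤ ∑ x : ι → α, (∏ k, p k (x k)) * (∑ i, g i (x i)) ^ 2 :=
        Finset.sum_le_sum_of_subset_of_nonneg (Finset.subset_univ _) fun x _ _ =>
          mul_nonneg (Finset.prod_nonneg fun k _ => hp0 _ _) (sq_nonneg _)
    _ = ∑ i, ∑ a, p i a * g i a ^ 2 := sum_prod_mul_sq_sum p hp g hg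
    _ ≤ ∑ _i : ι, V := Finset.sum_le_sum fun i _ => hV i
    _ = Fintype.card ι * V := by simp

/-- The random coding bound: the `(1+s)`-th moment of the average of `M` independent copies of `w`. -/
theorem randomCoding_moment_le {Z : Type*} [Fintype Z] (μ : Z → ℝ≥0∞)
    (hμ : ∑ z, μ z = 1) (w : Z → ℝ≥0∞) {M : ℕ} [NeZero M] {s : ℝ} (hs : 0 < s) (hs1 : s ≤ 1) :
    ∑ u : Fin M → Z, (∏ k, μ (u k)) * ((M : ℝ≥0∞)⁻¹ * ∑ m, w (u m)) ^ (1 + s)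
      ≤ ((M : ℝ≥0∞)⁻¹) ^ s * (∑ z, μ z * w z ^ (1 + s)) + (∑ z, μ z * w z) ^ (1 + s) := by
  set c : ℝ≥0∞ := (M : ℝ≥0∞)⁻¹ with hc
  have hcM : c * M = 1 :=
    ENNReal.inv_mul_cancel (by exact_mod_cast NeZero.ne M) (ENNReal.natCast_ne_top M)
  set E := ∑ z, μ z * w z with hE
  set A : (Fin M → Z) → ℝ≥0∞ := fun u => c * ∑ m, w (u m) with hA
  set B : Fin M → (Fin M → Z) → ℝ≥0∞ :=
    fun m u => c * ∑ k ∈ Finset.univ.erase m, w (u k) with hB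
  have hAB : ∀ m u, A u = c * w (u m) + B m u := fun m u => by
    simp only [hA, hB]
    rw [← Finset.add_sum_erase _ _ (Finset.mem_univ m), mul_add]
  -- Write `A ^ (1+s) = A * A ^ s` and expand only the first factor. In the `m`-th summand,
  -- subadditivity of `x ^ s` (`s ≤ 1`) splits off the contribution of the same codeword from that
  -- of the others.
  have hpow : ∀ u, A u ^ (1 + s) ≤ ∑ m, c * (c ^ s * w (u m) ^ (1 + s) + w (u m) * B m u ^ s) := by
    intro u
    have h1 : A u ^ (1 + s) = ∑ m, c * (w (u m) * A u ^ s) := by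
      rw [ENNReal.rpow_add_of_nonneg _ _ zero_le_one hs.le, ENNReal.rpow_one, ← Finset.mul_sum,
        ← Finset.sum_mul, ← mul_assoc]
    rw [h1]
    refine Finset.sum_le_sum fun m _ => ?_
    gcongr
    rw [hAB m u]
    calc w (u m) * (c * w (u m) + B m u) ^ s
        ≤ w (u m) * ((c * w (u m)) ^ s + B m u ^ s) := by
          gcongr; exact ENNReal.rpow_add_le_add_rpow _ _ hs.le hs1
      _ = _ := by
          rw [mul_add, ENNReal.mul_rpow_of_nonneg _ _ hs.le,
            ENNReal.rpow_add_of_nonneg _ _ zero_le_one hs.le, ENNReal.rpow_one]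
          ring
  have hcross : ∀ m, ∑ u : Fin M → Z, (∏ k, μ (u k)) * (w (u m) * B m u ^ s) ≤ E ^ (1 + s) := by
    intro m
    -- Concavity of `x ^ s`, as Hölder with weight `μ * w (u m)` of total mass `E`. It leaves the
    -- first moment of `B m`, which is independent of `w (u m)`.
    have h := ENNReal.inner_le_weight_mul_Lp_of_nonneg (Finset.univ : Finset (Fin M → Z))
      (p := s⁻¹) ((one_le_inv₀ hs).2 hs1) (fun u => (∏ k, μ (u k)) * w (u m))
      (fun u => B m u ^ s)
    simp only [inv_inv, ← ENNReal.rpow_mul, mul_inv_cancel₀ hs.ne', ENNReal.rpow_one] at h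
    rw [sum_prod_mul_apply (fun _ => μ) (fun _ => hμ) m w] at h
    have h2 : ∑ u : Fin M → Z, (∏ k, μ (u k)) * w (u m) * B m u ≤ E * E := by
      have : ∀ u : Fin M → Z, (∏ k, μ (u k)) * w (u m) * B m u
          = ∑ k ∈ Finset.univ.erase m, c * ((∏ k, μ (u k)) * (w (u m) * w (u k))) := fun u => by
        simp only [hB, Finset.mul_sum]
        exact Finset.sum_congr rfl fun k _ => by ring
      simp_rw [this]
      rw [Finset.sum_comm]
      calc _ = ∑ k ∈ Finset.univ.erase m, c * (E * E) := by
            refine Finset.sum_congr rfl fun k hk => ?_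
            rw [← Finset.mul_sum, sum_prod_mul_apply_mul_apply (fun _ => μ) (fun _ => hμ)
              (Finset.ne_of_mem_erase hk).symm w w]
        _ ≤ ∑ k : Fin M, c * (E * E) := Finset.sum_le_sum_of_subset (Finset.subset_univ _)
        _ = E * E := by
            rw [Finset.sum_const, Finset.card_univ, Fintype.card_fin, nsmul_eq_mul, ← mul_assoc,
              mul_comm _ c, hcM, one_mul]
    calc _ = ∑ u : Fin M → Z, (∏ k, μ (u k)) * w (u m) * B m u ^ s := by simp only [mul_assoc]
      _ ≤ _ := h
      _ ≤ E ^ (1 - s) * (E * E) ^ s := by gcongr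
      _ = E ^ (1 + s) := by
          rw [ENNReal.mul_rpow_of_nonneg _ _ hs.le,
            ← ENNReal.rpow_add_of_nonneg _ _ hs.le hs.le,
            ← ENNReal.rpow_add_of_nonneg _ _ (by linarith) (by linarith)]
          congr 1; ring
  calc ∑ u : Fin M → Z, (∏ k, μ (u k)) * A u ^ (1 + s)
      ≤ ∑ u : Fin M → Z, (∏ k, μ (u k)) *
          ∑ m, c * (c ^ s * w (u m) ^ (1 + s) + w (u m) * B m u ^ s) := by
        gcongr with u; exact hpow u
    _ = ∑ m, (c * (c ^ s * ∑ u : Fin M → Z, (∏ k, μ (u k)) * w (u m) ^ (1 + s))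
          + c * ∑ u : Fin M → Z, (∏ k, μ (u k)) * (w (u m) * B m u ^ s)) := by
        simp_rw [Finset.mul_sum]
        rw [Finset.sum_comm]
        refine Finset.sum_congr rfl fun m _ => ?_
        rw [← Finset.sum_add_distrib]
        exact Finset.sum_congr rfl fun u _ => by ring
    _ ≤ ∑ m : Fin M, (c * (c ^ s * ∑ z, μ z * w z ^ (1 + s)) + c * E ^ (1 + s)) := by
        refine Finset.sum_le_sum fun m _ => ?_
        rw [sum_prod_mul_apply (fun _ => μ) (fun _ => hμ) m fun z => w z ^ (1 + s)]
        gcongr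
        exact hcross m
    _ = _ := by
        rw [Finset.sum_const, Finset.card_univ, Fintype.card_fin, nsmul_eq_mul, ← mul_add,
          ← mul_assoc, mul_comm _ c, hcM, one_mul]

theorem pmf_toReal_pos {α : Type*} {P : PMF α} {a : α} (h : P a ≠ 0) : 0 < (P a).toReal :=
  ENNReal.toReal_pos h (P.apply_ne_top a)

/-- Hölder's inequality for the Rényi sum restricted to a set of letters. -/
theorem sum_rpow_mul_rpow_le {α : Type*} (P Q : PMF α) {s : ℝ} (hs : s < 0) (hs1 : -1 < s) (A : Finset α) :
    ∑ a ∈ A, P a ^ (1 + s) * Q a ^ (-s)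
      ≤ (∑ a ∈ A, P a) ^ (1 + s) * (∑ a ∈ A, Q a) ^ (-s) := by
  have hpq : ((1 + s)⁻¹).HolderConjugate ((-s)⁻¹) := by
    rw [Real.holderConjugate_iff]
    refine ⟨(one_lt_inv₀ (by linarith)).2 (by linarith), ?_⟩
    rw [inv_inv, inv_inv]; ring
  have h := ENNReal.inner_le_Lp_mul_Lq A (fun a => P a ^ (1 + s)) (fun a => Q a ^ (-s)) hpq
  simpa only [← ENNReal.rpow_mul, mul_inv_cancel₀ (by linarith : (1 + s) ≠ 0),
    mul_inv_cancel₀ (by linarith : -s ≠ 0), ENNReal.rpow_one, one_div, inv_inv] using h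

/-! ### Rényi divergences of two laws: conversion to sums and monotonicity in the order. -/

section basic

variable {α : Type*} [Fintype α]

theorem pmf_sum_eq_one (P : PMF α) : ∑ a, P a = 1 := by
  rw [← tsum_fintype (L := .unconditional _)]; exact P.tsum_coe

theorem pmf_sum_toReal_eq_one (P : PMF α) : ∑ a, (P a).toReal = 1 := by
  rw [← ENNReal.toReal_sum fun a _ => P.apply_ne_top a, pmf_sum_eq_one, ENNReal.toReal_one]

theorem ereal_coe_sum {ι : Type*} (s : Finset ι) (f : ι → ℝ) :
    ((∑ i ∈ s, f i : ℝ) : EReal) = ∑ i ∈ s, (f i : EReal) := by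
  classical
  induction s using Finset.induction_on with
  | empty => simp
  | insert a s ha ih => rw [Finset.sum_insert ha, Finset.sum_insert ha, EReal.coe_add, ih]

theorem log_le_coe_iff {x : ℝ≥0∞} {c : ℝ} :
    ENNReal.log x ≤ c ↔ x ≤ ENNReal.ofReal (Real.exp c) := by
  rw [← ENNReal.log_le_log_iff, ENNReal.log_ofReal_of_pos (Real.exp_pos c), Real.log_exp]

theorem coe_le_log_iff {x : ℝ≥0∞} {c : ℝ} :
    (c : EReal) ≤ ENNReal.log x ↔ ENNReal.ofReal (Real.exp c) ≤ x := by
  rw [← ENNReal.log_le_log_iff, ENNReal.log_ofReal_of_pos (Real.exp_pos c), Real.log_exp]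

theorem inv_mul_le_coe_iff {s c : ℝ} (hs : 0 < s) (L : EReal) :
    ((1 / s : ℝ) : EReal) * L ≤ c ↔ L ≤ ((s * c : ℝ) : EReal) := by
  have h : 0 < 1 / s := by positivity
  induction L with
  | bot => rw [EReal.coe_mul_bot_of_pos h]; simp [-EReal.coe_mul]
  | top => rw [EReal.coe_mul_top_of_pos h]; simp [-EReal.coe_mul]
  | coe x =>
    rw [← EReal.coe_mul, EReal.coe_le_coe_iff, EReal.coe_le_coe_iff, one_div,
      inv_mul_le_iff₀ hs]

theorem coe_le_inv_mul_iff {s c : ℝ} (hs : 0 < s) (L : EReal) :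
    (c : EReal) ≤ ((1 / s : ℝ) : EReal) * L ↔ ((s * c : ℝ) : EReal) ≤ L := by
  have h : 0 < 1 / s := by positivity
  induction L with
  | bot => rw [EReal.coe_mul_bot_of_pos h]; simp [-EReal.coe_mul]
  | top => rw [EReal.coe_mul_top_of_pos h]; simp [-EReal.coe_mul]
  | coe x =>
    rw [← EReal.coe_mul, EReal.coe_le_coe_iff, EReal.coe_le_coe_iff, one_div,
      le_inv_mul_iff₀ hs]

theorem inv_mul_le_coe_iff_of_neg {s c : ℝ} (hs : s < 0) (L : EReal) :
    ((1 / s : ℝ) : EReal) * L ≤ c ↔ ((s * c : ℝ) : EReal) ≤ L := by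
  have h : 1 / s < 0 := one_div_neg.2 hs
  induction L with
  | bot => rw [EReal.coe_mul_bot_of_neg h]; simp [-EReal.coe_mul]
  | top => rw [EReal.coe_mul_top_of_neg h]; simp [-EReal.coe_mul]
  | coe x =>
    rw [← EReal.coe_mul, EReal.coe_le_coe_iff, EReal.coe_le_coe_iff, one_div_mul_eq_div,
      div_le_iff_of_neg hs, mul_comm]

theorem coe_le_inv_mul_iff_of_neg {s c : ℝ} (hs : s < 0) (L : EReal) :
    (c : EReal) ≤ ((1 / s : ℝ) : EReal) * L ↔ L ≤ ((s * c : ℝ) : EReal) := by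
  have h : 1 / s < 0 := one_div_neg.2 hs
  induction L with
  | bot => rw [EReal.coe_mul_bot_of_neg h]; simp [-EReal.coe_mul]
  | top => rw [EReal.coe_mul_top_of_neg h]; simp [-EReal.coe_mul]
  | coe x =>
    rw [← EReal.coe_mul, EReal.coe_le_coe_iff, EReal.coe_le_coe_iff, one_div_mul_eq_div,
      le_div_iff_of_neg hs, mul_comm]

/-- The sum `∑ P ^ (1 + s) Q ^ (-s)` inside the Rényi divergence. -/
def renyiSum (s : ℝ) (P Q : PMF α) : ℝ≥0∞ := ∑ a, P a ^ (1 + s) * Q a ^ (-s)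

/-- The log-likelihood ratio, with junk value `0` where `P` or `Q` vanishes. -/
def logRatio (P Q : PMF α) (a : α) : ℝ := Real.log ((P a).toReal / (Q a).toReal)

theorem renyiDiv_of_ne_zero {s : ℝ} (hs : s ≠ 0) (P Q : PMF α) :
    renyiDiv s P Q = ((1 / s : ℝ) : EReal) * ENNReal.log (renyiSum s P Q) := by
  simp [renyiDiv, hs, renyiSum]

theorem renyiDiv_le_coe_iff {s c : ℝ} (hs : 0 < s) (P Q : PMF α) :
    renyiDiv s P Q ≤ c ↔ renyiSum s P Q ≤ ENNReal.ofReal (Real.exp (s * c)) := by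
  rw [renyiDiv_of_ne_zero hs.ne', inv_mul_le_coe_iff hs, log_le_coe_iff]

theorem coe_le_renyiDiv_iff {s c : ℝ} (hs : 0 < s) (P Q : PMF α) :
    (c : EReal) ≤ renyiDiv s P Q ↔ ENNReal.ofReal (Real.exp (s * c)) ≤ renyiSum s P Q := by
  rw [renyiDiv_of_ne_zero hs.ne', coe_le_inv_mul_iff hs, coe_le_log_iff]

theorem renyiDiv_le_coe_iff_of_neg {s c : ℝ} (hs : s < 0) (P Q : PMF α) :
    renyiDiv s P Q ≤ c ↔ ENNReal.ofReal (Real.exp (s * c)) ≤ renyiSum s P Q := by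
  rw [renyiDiv_of_ne_zero hs.ne, inv_mul_le_coe_iff_of_neg hs, coe_le_log_iff]

theorem coe_le_renyiDiv_iff_of_neg {s c : ℝ} (hs : s < 0) (P Q : PMF α) :
    (c : EReal) ≤ renyiDiv s P Q ↔ renyiSum s P Q ≤ ENNReal.ofReal (Real.exp (s * c)) := by
  rw [renyiDiv_of_ne_zero hs.ne, coe_le_inv_mul_iff_of_neg hs, log_le_coe_iff]

/-- Presents the Rényi sum as an exponential moment of the log-likelihood ratio under `P`, the form
to which Jensen and differentiation in `s` apply. The junk values of `logRatio` carry weight zero.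
-/
theorem renyiSum_eq_ofReal {P Q : PMF α} (hPQ : ∀ a, Q a = 0 → P a = 0) {s : ℝ} (hs : -1 < s) :
    renyiSum s P Q = ENNReal.ofReal (∑ a, (P a).toReal * Real.exp (s * logRatio P Q a)) := by
  rw [ENNReal.ofReal_sum_of_nonneg fun a _ => by positivity]
  refine Finset.sum_congr rfl fun a _ => ?_
  by_cases h : P a = 0
  · simp [h, ENNReal.zero_rpow_of_pos (by linarith : 0 < 1 + s)]
  · have hp := pmf_toReal_pos h
    have hq := pmf_toReal_pos fun h' => h (hPQ a h')
    have hp' : P a = ENNReal.ofReal (P a).toReal := (ENNReal.ofReal_toReal (P.apply_ne_top a)).symm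
    have hq' : Q a = ENNReal.ofReal (Q a).toReal := (ENNReal.ofReal_toReal (Q.apply_ne_top a)).symm
    conv_lhs => rw [hp', hq']
    rw [ENNReal.ofReal_rpow_of_pos hp, ENNReal.ofReal_rpow_of_pos hq,
      ← ENNReal.ofReal_mul (by positivity), logRatio, mul_comm s, ← Real.rpow_def_of_pos (by positivity),
      Real.rpow_add hp, Real.rpow_one, Real.rpow_neg hq.le, Real.div_rpow hp.le hq.le, mul_assoc,
      div_eq_mul_inv]

theorem renyiDiv_zero_eq_coe {P Q : PMF α} (hPQ : ∀ a, Q a = 0 → P a = 0) :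
    renyiDiv 0 P Q = ((∑ a, (P a).toReal * logRatio P Q a : ℝ) : EReal) := by
  rw [ereal_coe_sum, renyiDiv, if_pos rfl]
  refine Finset.sum_congr rfl fun a _ => ?_
  by_cases h : P a = 0
  · simp [h]
  · have hp := pmf_toReal_pos h
    have hq := pmf_toReal_pos fun h' => h (hPQ a h')
    have hdiv : P a / Q a ≠ ⊤ := ENNReal.div_ne_top (P.apply_ne_top a) fun h' => h (hPQ a h')
    have hdiv0 : P a / Q a ≠ 0 := (ENNReal.div_pos h (Q.apply_ne_top a)).ne'
    rw [ENNReal.log_pos_real hdiv0 hdiv, ENNReal.toReal_div, EReal.coe_mul,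
      EReal.coe_ennreal_toReal (P.apply_ne_top a), logRatio]

theorem renyiDiv_zero_eq_top {P Q : PMF α} {a : α} (hQ : Q a = 0) (hP : P a ≠ 0) :
    renyiDiv 0 P Q = ⊤ := by
  classical
  rw [renyiDiv, if_pos rfl, ← Finset.add_sum_erase _ _ (Finset.mem_univ a), hQ,
    ENNReal.div_zero hP, ENNReal.log_top, EReal.coe_ennreal_mul_top hP]
  -- In `EReal`, `⊤ + ⊥ = ⊥`, so the other summands must be shown to differ from `⊥`.
  refine EReal.top_add_of_ne_bot ?_
  have : ∀ b, (P b : EReal) * ENNReal.log (P b / Q b) ≠ ⊥ := fun b => by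
    by_cases h : P b = 0
    · simp [h]
    · have h1 : 0 < P b / Q b := ENNReal.div_pos h (Q.apply_ne_top b)
      have h2 : (0 : EReal) < P b := by
        rw [← EReal.coe_ennreal_zero, EReal.coe_ennreal_lt_coe_ennreal_iff]
        exact pos_iff_ne_zero.2 h
      rw [Ne, EReal.mul_eq_bot]
      have h3 : (P b : EReal) ≠ ⊤ := by simp [P.apply_ne_top b]
      have h4 : (P b : EReal) ≠ ⊥ := by simp
      have h5 : ENNReal.log (P b / Q b) ≠ ⊥ := by simpa using h1.ne'
      rintro (⟨h, _⟩ | ⟨_, h⟩ | ⟨h, _⟩ | ⟨h, _⟩)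
      exacts [h4 h, h5 h, h3 h, not_lt.2 h2.le h]
  refine Finset.sum_induction _ (fun x => x ≠ ⊥) (fun x y hx hy => ?_) (by simp) fun b _ => this b
  simp [EReal.add_eq_bot_iff, hx, hy]

theorem renyiSum_eq_top {P Q : PMF α} {a : α} (hQ : Q a = 0) (hP : P a ≠ 0) {s : ℝ} (hs : 0 < s) :
    renyiSum s P Q = ⊤ := by
  rw [renyiSum, ENNReal.sum_eq_top]
  refine ⟨a, Finset.mem_univ a, ?_⟩
  rw [hQ, ENNReal.zero_rpow_of_neg (by linarith), ENNReal.mul_top]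
  rw [Ne, ENNReal.rpow_eq_zero_iff]
  rintro (⟨h, _⟩ | ⟨h, _⟩)
  exacts [hP h, P.apply_ne_top a h]

theorem renyiDiv_eq_top {P Q : PMF α} {a : α} (hQ : Q a = 0) (hP : P a ≠ 0) {s : ℝ} (hs : 0 ≤ s) :
    renyiDiv s P Q = ⊤ := by
  rcases hs.eq_or_lt with rfl | hs
  · exact renyiDiv_zero_eq_top hQ hP
  · rw [renyiDiv_of_ne_zero hs.ne', renyiSum_eq_top hQ hP hs, ENNReal.log_top,
      EReal.coe_mul_top_of_pos (by positivity)]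

theorem exp_sum_le (P : PMF α) (g : α → ℝ) :
    Real.exp (∑ a, (P a).toReal * g a) ≤ ∑ a, (P a).toReal * Real.exp (g a) := by
  simpa using convexOn_exp.map_sum_le (t := Finset.univ) (w := fun a => (P a).toReal) (p := g)
    (fun _ _ => ENNReal.toReal_nonneg) (pmf_sum_toReal_eq_one P) (fun _ _ => Set.mem_univ _)

/-- The relative entropy is at most every Rényi divergence of larger order. -/
theorem renyiDiv_zero_le (P Q : PMF α) {s : ℝ} (hs : 0 < s) :
    renyiDiv 0 P Q ≤ renyiDiv s P Q := by
  by_cases hPQ : ∀ a, Q a = 0 → P a = 0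
  · rw [renyiDiv_zero_eq_coe hPQ, coe_le_renyiDiv_iff hs, renyiSum_eq_ofReal hPQ (by linarith)]
    refine ENNReal.ofReal_le_ofReal ?_
    have := exp_sum_le P fun a => s * logRatio P Q a
    convert this using 2
    rw [Finset.mul_sum]
    exact Finset.sum_congr rfl fun a _ => by ring
  · push Not at hPQ
    obtain ⟨a, h1, h2⟩ := hPQ
    rw [renyiDiv_eq_top h1 h2 hs.le]
    exact le_top

/-- The relative entropy is at least every Rényi divergence of smaller order. -/
theorem renyiDiv_le_zero (P Q : PMF α) {s : ℝ} (hs : s < 0) (hs1 : -1 < s) :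
    renyiDiv s P Q ≤ renyiDiv 0 P Q := by
  by_cases hPQ : ∀ a, Q a = 0 → P a = 0
  · rw [renyiDiv_zero_eq_coe hPQ, renyiDiv_le_coe_iff_of_neg hs, renyiSum_eq_ofReal hPQ hs1]
    refine ENNReal.ofReal_le_ofReal ?_
    have := exp_sum_le P fun a => s * logRatio P Q a
    convert this using 2
    rw [Finset.mul_sum]
    exact Finset.sum_congr rfl fun a _ => by ring
  · push Not at hPQ
    obtain ⟨a, h1, h2⟩ := hPQ
    rw [renyiDiv_eq_top h1 h2 le_rfl]
    exact le_top

theorem renyiSum_le_one (P Q : PMF α) {s : ℝ} (hs : s < 0) (hs1 : -1 < s) :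
    renyiSum s P Q ≤ 1 := by
  have := sum_rpow_mul_rpow_le P Q hs hs1 Finset.univ
  simpa [pmf_sum_eq_one, renyiSum] using this

theorem renyiDiv_neg_one (P Q : PMF α) : renyiDiv (-1) P Q = 0 := by
  rw [renyiDiv_of_ne_zero (by norm_num), renyiSum]
  simp [pmf_sum_eq_one]

/-- Hölder gives the case `-1 < s < 0`; larger orders follow by monotonicity, starting from `s = -1
/ 2`. -/
theorem renyiDiv_nonneg (P Q : PMF α) {s : ℝ} (hs : -1 ≤ s) : 0 ≤ renyiDiv s P Q := by
  have hneg : ∀ {t : ℝ}, t < 0 → -1 < t → 0 ≤ renyiDiv t P Q := fun {t} ht ht1 => by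
    rw [← EReal.coe_zero, coe_le_renyiDiv_iff_of_neg ht]
    simpa using renyiSum_le_one P Q ht ht1
  rcases hs.eq_or_lt with rfl | hs
  · rw [renyiDiv_neg_one]
  have h0 : 0 ≤ renyiDiv 0 P Q :=
    (hneg (t := -1 / 2) (by norm_num) (by norm_num)).trans
      (renyiDiv_le_zero P Q (by norm_num) (by norm_num))
  rcases lt_trichotomy s 0 with h | rfl | h
  · exact hneg h hs
  · exact h0
  · exact h0.trans (renyiDiv_zero_le P Q h)

end basic

/-! ### Rényi sums of product laws and of random codes. -/

theorem piLaw_apply {ι : Type*} [Fintype ι] [DecidableEq ι] {α : Type*} [Fintype α]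
    (P : ι → PMF α) (x : ι → α) : piLaw P x = ∏ i, P i (x i) := rfl

theorem outputLaw_apply {X : Type*} {Y : Type*} [Fintype Y] {M n : ℕ} [NeZero M] (W : X → PMF Y)
    (φ : Fin M → Fin n → X) (y : Fin n → Y) :
    outputLaw W φ y = (M : ℝ≥0∞)⁻¹ * ∑ m, ∏ i, W (φ m i) (y i) := rfl

theorem renyiSum_piLaw {ι : Type*} [Fintype ι] [DecidableEq ι] {α : Type*} [Fintype α]
    (P Q : ι → PMF α) (s : ℝ) :
    renyiSum s (piLaw P) (piLaw Q) = ∏ i, renyiSum s (P i) (Q i) := by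
  simp only [renyiSum]
  rw [← sum_prod_eq_prod_sum (fun i a => P i a ^ (1 + s) * Q i a ^ (-s))]
  refine Finset.sum_congr rfl fun x _ => ?_
  rw [piLaw_apply, piLaw_apply, Finset.prod_mul_distrib,
    ENNReal.prod_rpow_of_ne_top fun i _ => (P i).apply_ne_top _,
    ENNReal.prod_rpow_of_ne_top fun i _ => (Q i).apply_ne_top _]

/-- The Rényi sum of a random code is the average of those of its codebooks. -/
theorem renyiSum_joint_target {X : Type u} {Y : Type v} [Fintype Y] {M n : ℕ} [NeZero M]
    (c : RandomCode X M n) (W : X → PMF Y) (Q : PMF Y) {s : ℝ} (hs : -1 < s) :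
    renyiSum s (c.joint W) (c.target Q)
      = ∑ u, c.law u * renyiSum s (outputLaw W (c.map u)) (piLaw fun _ => Q) := by
  rw [renyiSum, Fintype.sum_prod_type_right]
  refine Finset.sum_congr rfl fun u _ => ?_
  rw [renyiSum, Finset.mul_sum]
  refine Finset.sum_congr rfl fun y _ => ?_
  have h1 : c.joint W (y, u) = c.law u * outputLaw W (c.map u) y := rfl
  have h2 : c.target Q (y, u) = piLaw (fun _ => Q) y * c.law u := rfl
  rw [h1, h2, ENNReal.mul_rpow_of_nonneg _ _ (by linarith),
    ENNReal.mul_rpow_of_ne_top (PMF.apply_ne_top _ _) (PMF.apply_ne_top _ _)]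
  -- The exponents `1 + s` and `-s` of the law of `u` add up to `1`, but `rpow_add` requires a
  -- nonzero base.
  by_cases h : c.law u = 0
  · simp [h, ENNReal.zero_rpow_of_pos (by linarith : 0 < 1 + s)]
  · have : c.law u ^ (1 + s) * c.law u ^ (-s) = c.law u := by
      rw [← ENNReal.rpow_add _ _ h (PMF.apply_ne_top _ _)]; simp
    calc _ = (c.law u ^ (1 + s) * c.law u ^ (-s)) * (outputLaw W (c.map u) y ^ (1 + s) *
          piLaw (fun _ => Q) y ^ (-s)) := by ring
      _ = _ := by rw [this]

/-- The input distributions inducing `Q`, as real vectors. -/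
def inputSimplex {X : Type u} {Y : Type v} [Fintype X] (W : X → PMF Y) (Q : PMF Y) :
    Set (X → ℝ) :=
  {p | p ∈ stdSimplex ℝ X ∧ ∀ y, ∑ x, p x * (W x y).toReal = (Q y).toReal}

/-- The divergence of a row of the channel, as a real number. -/
def rowDiv {X : Type u} {Y : Type v} [Fintype Y] (W : X → PMF Y) (Q : PMF Y) (s : ℝ) (x : X) : ℝ :=
  (renyiDiv s (W x) Q).toReal

/-! ### Divergences of the rows of the channel. -/

section rows

variable {X : Type u} {Y : Type v} [Fintype Y] {W : X → PMF Y} {Q : PMF Y}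

theorem coe_rowDiv {s : ℝ} (hs : 0 ≤ s) {x : X} (hx : ∀ y, Q y = 0 → W x y = 0) :
    (rowDiv W Q s x : EReal) = renyiDiv s (W x) Q := by
  refine EReal.coe_toReal ?_ fun h => ?_
  · rcases hs.eq_or_lt with rfl | hs
    · rw [renyiDiv_zero_eq_coe hx]; exact EReal.coe_ne_top _
    · rw [renyiDiv_of_ne_zero hs.ne', renyiSum_eq_ofReal hx (by linarith)]
      intro h
      rcases (EReal.mul_eq_top _ _).1 h with h | h | h | h
      · simp at h
      · exact absurd h.1 (by rw [not_lt]; exact_mod_cast (by positivity : 0 ≤ 1 / s))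
      · simp at h
      · exact ENNReal.ofReal_ne_top (ENNReal.log_eq_top_iff.1 h.2)
  · have := renyiDiv_nonneg (W x) Q (by linarith : -1 ≤ s)
    rw [h] at this
    simp at this

theorem rowDiv_nonneg (W : X → PMF Y) (Q : PMF Y) {s : ℝ} (hs : -1 ≤ s) (x : X) :
    0 ≤ rowDiv W Q s x :=
  EReal.toReal_nonneg (renyiDiv_nonneg _ _ hs)

theorem rowDiv_zero_eq {x : X} (hx : ∀ y, Q y = 0 → W x y = 0) :
    rowDiv W Q 0 x = ∑ y, (W x y).toReal * logRatio (W x) Q y := by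
  rw [rowDiv, renyiDiv_zero_eq_coe hx, EReal.toReal_coe]

theorem renyiSum_row_eq {s : ℝ} (hs : 0 < s) {x : X} (hx : ∀ y, Q y = 0 → W x y = 0) :
    renyiSum s (W x) Q = ENNReal.ofReal (Real.exp (s * rowDiv W Q s x)) := by
  refine le_antisymm ?_ ?_
  · rw [← renyiDiv_le_coe_iff hs, coe_rowDiv hs.le hx]
  · rw [← coe_le_renyiDiv_iff hs, coe_rowDiv hs.le hx]

/-- No absolute continuity is needed in this direction, since otherwise the right side is `⊤`. The
converse needs this because a codebook may use any row. -/
theorem le_renyiSum_row {s : ℝ} (hs : 0 < s) (W : X → PMF Y) (Q : PMF Y) (x : X) :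
    ENNReal.ofReal (Real.exp (s * rowDiv W Q s x)) ≤ renyiSum s (W x) Q := by
  by_cases hx : ∀ y, Q y = 0 → W x y = 0
  · exact (renyiSum_row_eq hs hx).ge
  · push Not at hx
    obtain ⟨y, h1, h2⟩ := hx
    rw [renyiSum_eq_top h1 h2 hs]
    exact le_top

end rows

/-! ### The polytope of inputs inducing `Q`, and attainment of the rate. -/

section inputs

variable {X : Type u} {Y : Type v} [Fintype X] {W : X → PMF Y} {Q : PMF Y}

theorem sum_mul_eq_of_mem_inputs {P : PMF X} (hP : P ∈ inputs W Q) (y : Y) :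
    ∑ x, P x * W x y = Q y := by
  have h : P.bind W = Q := hP
  rw [← h, PMF.bind_apply, tsum_fintype]

theorem toReal_mem_stdSimplex (P : PMF X) : (fun x => (P x).toReal) ∈ stdSimplex ℝ X :=
  ⟨fun _ => ENNReal.toReal_nonneg, pmf_sum_toReal_eq_one P⟩

theorem toReal_mem_inputSimplex {P : PMF X} (hP : P ∈ inputs W Q) :
    (fun x => (P x).toReal) ∈ inputSimplex W Q := by
  refine ⟨toReal_mem_stdSimplex P, fun y => ?_⟩
  rw [← sum_mul_eq_of_mem_inputs hP y, ENNReal.toReal_sum]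
  · exact Finset.sum_congr rfl fun x _ => ENNReal.toReal_mul.symm
  · exact fun x _ => ENNReal.mul_ne_top (P.apply_ne_top _) ((W x).apply_ne_top _)

theorem exists_mem_inputs {p : X → ℝ} (hp : p ∈ inputSimplex W Q) :
    ∃ P ∈ inputs W Q, ∀ x, (P x).toReal = p x := by
  obtain ⟨⟨h0, h1⟩, h2⟩ := hp
  refine ⟨PMF.ofFintype (fun x => ENNReal.ofReal (p x)) ?_, ?_, fun x => ?_⟩
  · rw [← ENNReal.ofReal_sum_of_nonneg fun x _ => h0 x, h1, ENNReal.ofReal_one]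
  · change PMF.bind _ W = Q
    ext y
    rw [PMF.bind_apply, tsum_fintype, ← ENNReal.ofReal_toReal (Q.apply_ne_top y), ← h2 y,
      ENNReal.ofReal_sum_of_nonneg fun x _ => mul_nonneg (h0 x) ENNReal.toReal_nonneg]
    refine Finset.sum_congr rfl fun x _ => ?_
    rw [ENNReal.ofReal_mul (h0 x), ENNReal.ofReal_toReal ((W x).apply_ne_top y)]
    rfl
  · exact ENNReal.toReal_ofReal (h0 x)

theorem absolutelyContinuous_of_mem_inputs {P : PMF X} (hP : P ∈ inputs W Q) {x : X}
    (hx : P x ≠ 0) (y : Y) (hy : Q y = 0) : W x y = 0 := by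
  have h := sum_mul_eq_of_mem_inputs hP y
  rw [hy, Finset.sum_eq_zero_iff] at h
  exact (mul_eq_zero.1 (h x (Finset.mem_univ x))).resolve_left hx

theorem isCompact_inputSimplex (W : X → PMF Y) (Q : PMF Y) : IsCompact (inputSimplex W Q) := by
  refine (isCompact_stdSimplex ℝ X).inter_right (t := {p | ∀ y, ∑ x, p x * (W x y).toReal
    = (Q y).toReal}) ?_
  rw [Set.ofPred_forall]
  exact isClosed_iInter fun y => isClosed_eq (by fun_prop) continuous_const

/-- A lower bound for a linear function on the inputs inducing `Q` holds approximately on the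
inputs that approximately induce `Q`. -/
theorem exists_forall_sub_le_sum [Fintype Y] {d : X → ℝ} {r η : ℝ} (hη : 0 < η)
    (hr : ∀ p ∈ inputSimplex W Q, r ≤ ∑ x, p x * d x) :
    ∃ ε > 0, ∀ t ∈ stdSimplex ℝ X,
      (∀ y, |∑ x, t x * (W x y).toReal - (Q y).toReal| ≤ ε) → r - η ≤ ∑ x, t x * d x := by
  -- `K` holds the offending distributions. None of them induces `Q` exactly, so the mismatch `G` is
  -- positive on `K`, and compactness gives it a positive minimum.
  set K : Set (X → ℝ) := {t | t ∈ stdSimplex ℝ X ∧ ∑ x, t x * d x ≤ r - η} with hK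
  have hKc : IsCompact K := (isCompact_stdSimplex ℝ X).inter_right
    (t := {t : X → ℝ | ∑ x, t x * d x ≤ r - η})
    (isClosed_le (by fun_prop) continuous_const)
  set G : (X → ℝ) → ℝ := fun t => ∑ y, |∑ x, t x * (W x y).toReal - (Q y).toReal| with hG
  have hGc : Continuous G := by fun_prop
  rcases K.eq_empty_or_nonempty with hE | hne
  · refine ⟨1, one_pos, fun t ht _ => ?_⟩
    by_contra hlt
    have : t ∈ K := ⟨ht, (not_le.1 hlt).le⟩
    simp [hE] at this
  obtain ⟨t₀, ht₀, hmin⟩ := hKc.exists_isMinOn hne hGc.continuousOn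
  have hpos : 0 < G t₀ := by
    refine lt_of_le_of_ne (Finset.sum_nonneg fun _ _ => abs_nonneg _) fun h0 => ?_
    have h1 := (Finset.sum_eq_zero_iff_of_nonneg fun _ _ => abs_nonneg _).1 h0.symm
    have : t₀ ∈ inputSimplex W Q :=
      ⟨ht₀.1, fun y => sub_eq_zero.1 (abs_eq_zero.1 (h1 y (Finset.mem_univ y)))⟩
    have h2 := ht₀.2
    linarith [hr _ this]
  -- The `+ 1` makes the sum of `card Y` coordinate errors strictly smaller than the minimum `G t₀`.
  refine ⟨G t₀ / (Fintype.card Y + 1), by positivity, fun t ht hty => ?_⟩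
  by_contra hlt
  have h1 : G t₀ ≤ G t := hmin (show t ∈ K from ⟨ht, (not_le.1 hlt).le⟩)
  have h2 : G t ≤ Fintype.card Y * (G t₀ / (Fintype.card Y + 1)) := by
    calc G t ≤ ∑ _y : Y, G t₀ / (Fintype.card Y + 1) := Finset.sum_le_sum fun y _ => hty y
      _ = _ := by simp
  have h3 : (Fintype.card Y : ℝ) * (G t₀ / (Fintype.card Y + 1)) < G t₀ := by
    rw [mul_div_assoc', div_lt_iff₀ (by positivity)]
    nlinarith
  linarith

variable [Fintype Y]

theorem meanDiv_eq_coe {s : ℝ} (hs : 0 ≤ s) {P : PMF X} (hP : P ∈ inputs W Q) :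
    meanDiv W Q s P = ((∑ x, (P x).toReal * rowDiv W Q s x : ℝ) : EReal) := by
  rw [ereal_coe_sum, meanDiv]
  refine Finset.sum_congr rfl fun x _ => ?_
  by_cases hx : P x = 0
  · simp [hx]
  · rw [EReal.coe_mul, EReal.coe_ennreal_toReal (P.apply_ne_top x),
      coe_rowDiv hs (absolutelyContinuous_of_mem_inputs hP hx)]

/-- The minimum defining the rate is attained. -/
theorem exists_rate_eq (hQ : (inputs W Q).Nonempty) {s : ℝ} (hs : s ≠ -1) :
    ∃ P ∈ inputs W Q, meanDiv W Q (max s 0) P = rate W Q s ∧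
      ∀ p ∈ inputSimplex W Q, ∑ x, (P x).toReal * rowDiv W Q (max s 0) x
        ≤ ∑ x, p x * rowDiv W Q (max s 0) x := by
  obtain ⟨P₀, hP₀⟩ := hQ
  obtain ⟨p, hp, hmin⟩ := (isCompact_inputSimplex W Q).exists_isMinOn
    ⟨_, toReal_mem_inputSimplex hP₀⟩
    (f := fun p : X → ℝ => ∑ x, p x * rowDiv W Q (max s 0) x) (by fun_prop)
  obtain ⟨P, hP, hPp⟩ := exists_mem_inputs hp
  have hle : ∀ p' ∈ inputSimplex W Q, ∑ x, (P x).toReal * rowDiv W Q (max s 0) x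
        ≤ ∑ x, p' x * rowDiv W Q (max s 0) x := fun p' hp' => by
    simp_rw [hPp]; exact hmin hp'
  refine ⟨P, hP, ?_, hle⟩
  rw [rate, if_neg hs]
  refine le_antisymm (le_iInf₂ fun P' hP' => ?_) (iInf₂_le P hP)
  rw [meanDiv_eq_coe (le_max_right _ _) hP, meanDiv_eq_coe (le_max_right _ _) hP',
    EReal.coe_le_coe_iff]
  exact hle _ (toReal_mem_inputSimplex hP')

end inputs

/-! ### Limits in `EReal` and the number of messages. -/

theorem tendsto_zero_of_nonneg_of_eventually_le {f : ℕ → EReal} (h0 : ∀ n, 0 ≤ f n)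
    (h : ∀ δ : ℝ, 0 < δ → ∀ᶠ n in atTop, f n ≤ δ) : Tendsto f atTop (𝓝 0) := by
  rw [tendsto_order]
  refine ⟨fun a ha => Eventually.of_forall fun n => ha.trans_le (h0 n), fun a ha => ?_⟩
  obtain ⟨δ, hδ0, hδ⟩ := EReal.lt_iff_exists_real_btwn.1 ha
  filter_upwards [h δ (by exact_mod_cast hδ0)] with n hn using hn.trans_lt hδ

theorem exp_le_numMessages (R : ℝ) (n : ℕ) : Real.exp (n * R) ≤ numMessages R n :=
  Nat.le_ceil _

theorem numMessages_le {R : ℝ} (hR : 0 < R) (n : ℕ) :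
    (numMessages R n : ℝ) ≤ 2 * Real.exp (n * R) := by
  have h1 : 1 ≤ Real.exp (n * R) := Real.one_le_exp (by positivity)
  have h2 : (numMessages R n : ℝ) < Real.exp (n * R) + 1 :=
    Nat.ceil_lt_add_one (Real.exp_pos _).le
  linarith

/-! ### The typical set and the conditioned product law. -/

section typical

variable {X : Type u} [Fintype X]

/-- The probability of the typical set. -/
def typicalProb (P : PMF X) (ε : ℝ) (n : ℕ) : ℝ≥0∞ :=
  ∑ x, (typicalSet P ε n).indicator (piLaw fun _ : Fin n => P) x

theorem piLaw_toReal {ι : Type*} [Fintype ι] [DecidableEq ι] (P : ι → PMF X) (x : ι → X) :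
    (piLaw P x).toReal = ∏ i, (P i (x i)).toReal := by
  rw [piLaw_apply, ENNReal.toReal_prod]

-- Chebyshev for the indicator of `a`, whose variance is at most `1`. If `P a = 0` the right side is
-- `0` by division by zero, and this is correct: a deviating word contains `a` and has probability
-- zero.
open Classical in
theorem sum_piLaw_deviation_le (P : PMF X) {ε : ℝ} (hε : 0 < ε) {n : ℕ} (hn : 0 < n) (a : X) :
    ∑ x : Fin n → X with ¬ |((Finset.univ.filter fun i => x i = a).card : ℝ) / n - (P a).toReal|
        ≤ ε * (P a).toReal, (piLaw (fun _ : Fin n => P) x).toReal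
      ≤ 1 / (ε * (P a).toReal) ^ 2 / n := by
  have hn' : (0 : ℝ) < n := by exact_mod_cast hn
  by_cases ha : P a = 0
  · simp only [ha, ENNReal.toReal_zero, mul_zero, sub_zero, ne_eq, OfNat.ofNat_ne_zero,
      not_false_eq_true, zero_pow, div_zero, zero_div]
    refine le_of_eq (Finset.sum_eq_zero fun x hx => ?_)
    rw [Finset.mem_filter] at hx
    have : ∃ i, x i = a := by
      by_contra hcon
      push Not at hcon
      exact hx.2 (by simp [Finset.filter_eq_empty_iff.2 fun i _ => hcon i])
    obtain ⟨i, hi⟩ := this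
    rw [piLaw_toReal]
    exact Finset.prod_eq_zero (Finset.mem_univ i) (by rw [hi, ha, ENNReal.toReal_zero])
  · have hp := pmf_toReal_pos ha
    have hp1 : (P a).toReal ≤ 1 := ENNReal.toReal_le_of_le_ofReal zero_le_one (by
      simpa using P.coe_le_one a)
    simp_rw [piLaw_toReal]
    have hind : ∑ b, (P b).toReal * (if b = a then (1 : ℝ) else 0) = (P a).toReal := by simp
    have key := sum_prod_filter_le_of_variance (fun (_ : Fin n) b => (P b).toReal)
      (fun _ _ => ENNReal.toReal_nonneg) (fun _ => pmf_sum_toReal_eq_one P)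
      (fun _ b => (if b = a then (1 : ℝ) else 0) - (P a).toReal) (fun _ => ?_) (V := 1)
      (fun _ => ?_) (t := n * (ε * (P a).toReal)) (by positivity)
      (Finset.univ.filter fun x : Fin n → X =>
        ¬ |((Finset.univ.filter fun i => x i = a).card : ℝ) / n - (P a).toReal|
        ≤ ε * (P a).toReal) (fun x hx => ?_)
    · refine key.trans (le_of_eq ?_)
      rw [Fintype.card_fin]
      field_simp
    · simp only [mul_sub, Finset.sum_sub_distrib]
      rw [hind, ← Finset.sum_mul, pmf_sum_toReal_eq_one, one_mul, sub_self]
    · calc ∑ b, (P b).toReal * ((if b = a then (1 : ℝ) else 0) - (P a).toReal) ^ 2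
          ≤ ∑ b, (P b).toReal * 1 := by
            refine Finset.sum_le_sum fun b _ => ?_
            refine mul_le_mul_of_nonneg_left ?_ ENNReal.toReal_nonneg
            split_ifs
            · nlinarith
            · nlinarith
        _ = 1 := by simp [pmf_sum_toReal_eq_one]
    · rw [Finset.mem_filter, not_le] at hx
      have h1 : ∑ i, ((if x i = a then (1 : ℝ) else 0) - (P a).toReal)
          = n * (((Finset.univ.filter fun i => x i = a).card : ℝ) / n - (P a).toReal) := by
        rw [Finset.sum_sub_distrib, Finset.sum_boole]
        simp
        field_simp
      rw [h1, abs_mul, abs_of_pos hn']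
      gcongr
      exact hx.2.le

/-- Union bound over the letters of the Chebyshev estimates, each of order `1 / n`. -/
theorem tendsto_typicalProb (P : PMF X) {ε : ℝ} (hε : 0 < ε) :
    Tendsto (typicalProb P ε) atTop (𝓝 1) := by
  classical
  set b : ℕ → ℝ := fun n => ∑ a, 1 / (ε * (P a).toReal) ^ 2 / n with hb
  have hb0 : Tendsto b atTop (𝓝 0) := by
    rw [← Finset.sum_const_zero (s := (Finset.univ : Finset X))]
    exact tendsto_finsetSum _ fun a _ => tendsto_const_div_atTop_nhds_zero_nat _
  have hlow : Tendsto (fun n => ENNReal.ofReal (1 - b n)) atTop (𝓝 1) := by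
    rw [← ENNReal.ofReal_one]
    refine ENNReal.tendsto_ofReal ?_
    simpa using tendsto_const_nhds.sub hb0
  have hle1 : ∀ n, typicalProb P ε n ≤ 1 := fun n => by
    rw [← pmf_sum_eq_one (piLaw fun _ : Fin n => P)]
    exact Finset.sum_le_sum fun x _ => Set.indicator_le_self _ _ x
  refine tendsto_of_tendsto_of_tendsto_of_le_of_le' hlow tendsto_const_nhds ?_
    (Eventually.of_forall hle1)
  filter_upwards [eventually_gt_atTop 0] with n hn
  have hsum : ∑ x : Fin n → X, (piLaw (fun _ : Fin n => P) x).toReal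
      ≤ (typicalProb P ε n).toReal + b n := by
    rw [typicalProb, ENNReal.toReal_sum fun x _ => ?_]
    · rw [hb]
      simp only
      calc ∑ x : Fin n → X, (piLaw (fun _ : Fin n => P) x).toReal
          ≤ ∑ x : Fin n → X, (((typicalSet P ε n).indicator (piLaw fun _ : Fin n => P) x).toReal
            + ∑ a, if ¬ |((Finset.univ.filter fun i => x i = a).card : ℝ) / n - (P a).toReal|
              ≤ ε * (P a).toReal then (piLaw (fun _ : Fin n => P) x).toReal else 0) := by
            refine Finset.sum_le_sum fun x _ => ?_
            by_cases hx : x ∈ typicalSet P ε n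
            · rw [Set.indicator_of_mem hx]
              refine le_add_of_nonneg_right (Finset.sum_nonneg fun a _ => ?_)
              split_ifs <;> simp
            · rw [Set.indicator_of_notMem hx, ENNReal.toReal_zero, zero_add]
              have hx' : ∃ a, ¬ |((Finset.univ.filter fun i => x i = a).card : ℝ) / n
                  - (P a).toReal| ≤ ε * (P a).toReal := by
                by_contra hcon
                push Not at hcon
                exact hx fun a => by convert hcon a
              obtain ⟨a, ha⟩ := hx'
              have := Finset.single_le_sum (s := Finset.univ) (f := fun a =>
                if ¬ |((Finset.univ.filter fun i => x i = a).card : ℝ) / n - (P a).toReal|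
                  ≤ ε * (P a).toReal then (piLaw (fun _ : Fin n => P) x).toReal else 0)
                (fun a _ => by split_ifs <;> simp) (Finset.mem_univ a)
              simp only [if_pos ha] at this
              exact this
        _ = _ := by
            rw [Finset.sum_add_distrib, Finset.sum_comm (s := Finset.univ (α := Fin n → X))]
        _ ≤ _ := by
            refine add_le_add_right (Finset.sum_le_sum fun a _ => ?_) _
            rw [← Finset.sum_filter]
            convert sum_piLaw_deviation_le P hε hn a
    · rw [Set.indicator_apply]
      split_ifs
      · exact PMF.apply_ne_top _ _
      · simp
  rw [pmf_sum_toReal_eq_one] at hsum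
  refine ENNReal.ofReal_le_of_le_toReal (by linarith)

theorem typicalLaw_apply {P : PMF X} {ε : ℝ} {n : ℕ} (h : typicalProb P ε n ≠ 0) (x : Fin n → X) :
    typicalLaw P ε n x = (typicalSet P ε n).indicator (piLaw fun _ : Fin n => P) x
      * (typicalProb P ε n)⁻¹ := by
  have hex : ∃ x ∈ typicalSet P ε n, x ∈ (piLaw fun _ : Fin n => P).support := by
    by_contra hcon
    push Not at hcon
    refine h (Finset.sum_eq_zero fun x _ => ?_)
    by_cases hx : x ∈ typicalSet P ε n
    · rw [Set.indicator_of_mem hx]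
      simpa [PMF.mem_support_iff] using hcon x hx
    · rw [Set.indicator_of_notMem hx]
  rw [typicalLaw, dif_pos hex, PMF.filter_apply, tsum_fintype]
  rfl

theorem typicalLaw_le {P : PMF X} {ε : ℝ} {n : ℕ} (h : typicalProb P ε n ≠ 0) (x : Fin n → X) :
    typicalLaw P ε n x ≤ (typicalProb P ε n)⁻¹ * ∏ i, P (x i) := by
  rw [typicalLaw_apply h, mul_comm]
  gcongr
  exact Set.indicator_le_self _ _ x

/-- The tolerance is relative to `P a`, so each letter count is at most `n * (1 + ε) * P a`. This is
why typical codewords have a Rényi sum governed by the mean of the row divergences. -/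
theorem sum_apply_le_of_mem_typicalSet {P : PMF X} {ε : ℝ} {n : ℕ} {x : Fin n → X}
    (hx : x ∈ typicalSet P ε n) {d : X → ℝ} (hd : ∀ a, 0 ≤ d a) :
    ∑ i, d (x i) ≤ n * ((1 + ε) * ∑ a, (P a).toReal * d a) := by
  classical
  rcases Nat.eq_zero_or_pos n with rfl | hn
  · simp
  have hn' : (0 : ℝ) < n := by exact_mod_cast hn
  rw [← Finset.sum_fiberwise' Finset.univ x d, Finset.mul_sum, Finset.mul_sum]
  refine Finset.sum_le_sum fun a _ => ?_
  rw [Finset.sum_const, nsmul_eq_mul]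
  have h1 := (abs_le.1 (hx a)).2
  have h2 : ((Finset.univ.filter fun i => x i = a).card : ℝ) ≤ n * ((1 + ε) * (P a).toReal) := by
    have : ((Finset.univ.filter fun i => x i = a).card : ℝ) / n ≤ (1 + ε) * (P a).toReal := by
      convert (sub_le_iff_le_add.1 h1).trans (by linarith :
        _ ≤ (1 + ε) * (P a).toReal) using 4
    rw [div_le_iff₀ hn'] at this
    linarith
  calc _ ≤ n * ((1 + ε) * (P a).toReal) * d a := by
        refine mul_le_mul_of_nonneg_right ?_ (hd a)
        convert h2 using 3
    _ = _ := by ring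

end typical

/-! ### Achievability by typical-set codes. -/

section achievability

variable {X : Type u} {Y : Type v} [Fintype X] [Fintype Y] {W : X → PMF Y} {Q : PMF Y}

/-- Exchange the sums over codebooks and outputs and apply `randomCoding_moment_le` at each output
`y`. -/
theorem renyiSum_conventional_le (W : X → PMF Y) (Q : PMF Y) {n M : ℕ} [NeZero M]
    (μ : PMF (Fin n → X)) {s : ℝ} (hs : 0 < s) (hs1 : s ≤ 1) :
    renyiSum s ((RandomCode.conventional M μ).joint W) ((RandomCode.conventional M μ).target Q)
      ≤ ((M : ℝ≥0∞)⁻¹) ^ s *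
          ∑ z, μ z * renyiSum s (piLaw fun i => W (z i)) (piLaw fun _ => Q)
        + ∑ y, (∑ z, μ z * ∏ i, W (z i) (y i)) ^ (1 + s) * piLaw (fun _ => Q) y ^ (-s) := by
  rw [renyiSum_joint_target _ _ _ (by linarith)]
  change ∑ u : Fin M → Fin n → X, (∏ k, μ (u k)) *
    ∑ y, ((M : ℝ≥0∞)⁻¹ * ∑ m, ∏ i, W (u m i) (y i)) ^ (1 + s) * piLaw (fun _ => Q) y ^ (-s) ≤ _
  calc _ = ∑ y, (∑ u : Fin M → Fin n → X, (∏ k, μ (u k)) *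
        ((M : ℝ≥0∞)⁻¹ * ∑ m, ∏ i, W (u m i) (y i)) ^ (1 + s)) * piLaw (fun _ => Q) y ^ (-s) := by
        simp_rw [Finset.mul_sum, Finset.sum_mul]
        rw [Finset.sum_comm]
        simp_rw [mul_assoc]
    _ ≤ ∑ y, (((M : ℝ≥0∞)⁻¹) ^ s * (∑ z, μ z * (∏ i, W (z i) (y i)) ^ (1 + s))
          + (∑ z, μ z * ∏ i, W (z i) (y i)) ^ (1 + s)) * piLaw (fun _ => Q) y ^ (-s) := by
        gcongr with y
        exact randomCoding_moment_le μ (pmf_sum_eq_one μ) (fun z => ∏ i, W (z i) (y i)) hs hs1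
    _ = _ := by
        simp_rw [add_mul]
        rw [Finset.sum_add_distrib]
        congr 1
        simp_rw [renyiSum, Finset.mul_sum, Finset.sum_mul]
        rw [Finset.sum_comm]
        simp_rw [mul_assoc]
        rfl

/-- In the self-term, tensorization and typicality bound the Rényi sum of every codeword in the
support. In the other term, the mixture output is at most `(typicalProb P ε n)⁻¹` times `Q ^ n`
pointwise. -/
theorem renyiSum_typical_le {P : PMF X} (hP : P ∈ inputs W Q) {s : ℝ} (hs : 0 < s) (hs1 : s ≤ 1)
    (R ε : ℝ) {n : ℕ} (h : typicalProb P ε n ≠ 0) :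
    renyiSum s ((RandomCode.conventional (numMessages R n) (typicalLaw P ε n)).joint W)
        ((RandomCode.conventional (numMessages R n) (typicalLaw P ε n)).target Q)
      ≤ ENNReal.ofReal (Real.exp
          (-(s * (R - (1 + ε) * ∑ a, (P a).toReal * rowDiv W Q s a)) * n))
        + ((typicalProb P ε n)⁻¹) ^ (1 + s) := by
  refine (renyiSum_conventional_le W Q _ hs hs1).trans (add_le_add ?_ ?_)
  · set D := ∑ a, (P a).toReal * rowDiv W Q s a
    have hz : ∀ z, typicalLaw P ε n z * renyiSum s (piLaw fun i => W (z i)) (piLaw fun _ => Q)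
        ≤ typicalLaw P ε n z * ENNReal.ofReal (Real.exp (s * (n * ((1 + ε) * D)))) := fun z => by
      by_cases hz : typicalLaw P ε n z = 0
      · simp [hz]
      refine mul_le_mul_right ?_ _
      rw [typicalLaw_apply h] at hz
      have hz1 := left_ne_zero_of_mul hz
      have hzT : z ∈ typicalSet P ε n := Set.mem_of_indicator_ne_zero hz1
      rw [Set.indicator_of_mem hzT, piLaw_apply] at hz1
      have hzi : ∀ i, P (z i) ≠ 0 := fun i hi => hz1 (Finset.prod_eq_zero (Finset.mem_univ i) hi)
      rw [renyiSum_piLaw]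
      calc ∏ i, renyiSum s (W (z i)) Q
          = ∏ i, ENNReal.ofReal (Real.exp (s * rowDiv W Q s (z i))) :=
            Finset.prod_congr rfl fun i _ =>
              renyiSum_row_eq hs (absolutelyContinuous_of_mem_inputs hP (hzi i))
        _ = ENNReal.ofReal (Real.exp (s * ∑ i, rowDiv W Q s (z i))) := by
            rw [← ENNReal.ofReal_prod_of_nonneg fun i _ => (Real.exp_pos _).le, ← Real.exp_sum,
              Finset.mul_sum]
        _ ≤ _ := by
            gcongr
            exact sum_apply_le_of_mem_typicalSet hzT fun a => rowDiv_nonneg W Q (by linarith) a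
    have hM : ((numMessages R n : ℝ≥0∞)⁻¹) ^ s ≤ ENNReal.ofReal (Real.exp (-(n * R) * s)) := by
      have : (numMessages R n : ℝ≥0∞)⁻¹ ≤ ENNReal.ofReal (Real.exp (-(n * R))) := by
        rw [Real.exp_neg, ENNReal.ofReal_inv_of_pos (Real.exp_pos _), ENNReal.inv_le_inv,
          ← ENNReal.ofReal_natCast]
        exact ENNReal.ofReal_le_ofReal (exp_le_numMessages R n)
      rw [Real.exp_mul, ← ENNReal.ofReal_rpow_of_pos (Real.exp_pos _)]
      gcongr
    calc _ ≤ ENNReal.ofReal (Real.exp (-(n * R) * s)) *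
          ∑ z, typicalLaw P ε n z * ENNReal.ofReal (Real.exp (s * (n * ((1 + ε) * D)))) := by
          exact mul_le_mul' hM (Finset.sum_le_sum fun z _ => hz z)
      _ = _ := by
          rw [← Finset.sum_mul, pmf_sum_eq_one, one_mul, ← ENNReal.ofReal_mul (Real.exp_pos _).le,
            ← Real.exp_add]
          congr 2
          ring
  · have hz : ∀ y : Fin n → Y, ∑ z, typicalLaw P ε n z * ∏ i, W (z i) (y i)
        ≤ (typicalProb P ε n)⁻¹ * piLaw (fun _ => Q) y := fun y => by
      calc _ ≤ ∑ z : Fin n → X, ((typicalProb P ε n)⁻¹ * ∏ i, P (z i)) * ∏ i, W (z i) (y i) := by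
            gcongr with z
            exact typicalLaw_le h z
        _ = (typicalProb P ε n)⁻¹ * ∑ z : Fin n → X, ∏ i, P (z i) * W (z i) (y i) := by
            rw [Finset.mul_sum]
            exact Finset.sum_congr rfl fun z _ => by rw [Finset.prod_mul_distrib, mul_assoc]
        _ = _ := by
            rw [sum_prod_eq_prod_sum (fun i a => P a * W a (y i)), piLaw_apply]
            simp_rw [sum_mul_eq_of_mem_inputs hP]
    calc _ ≤ ∑ y : Fin n → Y, ((typicalProb P ε n)⁻¹ * piLaw (fun _ => Q) y) ^ (1 + s)
          * piLaw (fun _ => Q) y ^ (-s) := by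
          gcongr with y
          exact hz y
      _ = ((typicalProb P ε n)⁻¹) ^ (1 + s) * renyiSum s (piLaw fun _ : Fin n => Q)
          (piLaw fun _ => Q) := by
          rw [renyiSum, Finset.mul_sum]
          refine Finset.sum_congr rfl fun y _ => ?_
          rw [ENNReal.mul_rpow_of_nonneg _ _ (by linarith), mul_assoc]
      _ = _ := by
          rw [renyiSum_eq_ofReal (fun _ h => h) (by linarith)]
          have : ∀ y : Fin n → Y, logRatio (piLaw fun _ : Fin n => Q) (piLaw fun _ => Q) y = 0 :=
            fun y => by
              rw [logRatio]
              by_cases h0 : (piLaw (fun _ : Fin n => Q) y).toReal = 0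
              · simp [h0]
              · rw [div_self h0, Real.log_one]
          simp [this, pmf_sum_toReal_eq_one]

theorem tendsto_renyiDiv_typical_of_pos {P : PMF X} (hP : P ∈ inputs W Q) {s : ℝ} (hs : 0 < s)
    (hs1 : s ≤ 1) {R : ℝ} (hR : ∑ a, (P a).toReal * rowDiv W Q s a < R) :
    ∃ ε > 0, Tendsto (fun n => renyiDiv s
      ((RandomCode.conventional (numMessages R n) (typicalLaw P ε n)).joint W)
      ((RandomCode.conventional (numMessages R n) (typicalLaw P ε n)).target Q)) atTop (𝓝 0) := by
  set D := ∑ a, (P a).toReal * rowDiv W Q s a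
  have hD : 0 ≤ D := Finset.sum_nonneg fun a _ =>
    mul_nonneg ENNReal.toReal_nonneg (rowDiv_nonneg W Q (by linarith) a)
  -- Chosen so that `ε * D` uses up less than half of the gap `R - D`; `D + 1` avoids dividing by
  -- zero.
  set ε := (R - D) / (2 * (D + 1)) with hεdef
  have hε : 0 < ε := div_pos (by linarith) (by linarith)
  have hεD : ε * (D + 1) = (R - D) / 2 := by rw [hεdef]; field_simp
  have hgap : 0 < R - (1 + ε) * D := by nlinarith
  refine ⟨ε, hε, tendsto_zero_of_nonneg_of_eventually_le
    (fun n => renyiDiv_nonneg _ _ (by linarith)) fun δ hδ => ?_⟩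
  have hc := tendsto_typicalProb P hε
  have h1 : Tendsto (fun n : ℕ => ENNReal.ofReal (Real.exp (-(s * (R - (1 + ε) * D)) * n)))
      atTop (𝓝 0) := by
    rw [← ENNReal.ofReal_zero]
    refine ENNReal.tendsto_ofReal (Real.tendsto_exp_atBot.comp ?_)
    exact tendsto_natCast_atTop_atTop.const_mul_atTop_of_neg (neg_lt_zero.2 (by positivity))
  have h2 : Tendsto (fun n : ℕ => ((typicalProb P ε n)⁻¹) ^ (1 + s)) atTop (𝓝 1) := by
    have := ((ENNReal.continuous_rpow_const (y := 1 + s)).tendsto _).comp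
      (tendsto_inv_iff.2 hc)
    simpa [Function.comp_def] using this
  have h3 := h1.add h2
  rw [zero_add] at h3
  have hlt : 1 < ENNReal.ofReal (Real.exp (s * δ)) := by
    rw [← ENNReal.ofReal_one, ENNReal.ofReal_lt_ofReal_iff (Real.exp_pos _), Real.one_lt_exp_iff]
    positivity
  filter_upwards [h3.eventually_lt_const hlt, hc.eventually_ne one_ne_zero] with n hn hn0
  rw [renyiDiv_le_coe_iff hs]
  exact (renyiSum_typical_le hP hs hs1 R ε hn0).trans hn.le

/-- Letting `s` decrease to `0`, the average Rényi divergence decreases to the conditional relative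
entropy. -/
theorem exists_sum_rowDiv_lt {P : PMF X} (hP : P ∈ inputs W Q) {R : ℝ}
    (hR : ∑ a, (P a).toReal * rowDiv W Q 0 a < R) :
    ∃ s, 0 < s ∧ s ≤ 1 ∧ ∑ a, (P a).toReal * rowDiv W Q s a < R := by
  -- For `t > 0`, `F t / t` is the mean divergence of order `1 + t`. Since `F 0 = 0`, its limit at
  -- `0` is the derivative `F' 0`, the conditional relative entropy.
  set F : ℝ → ℝ := fun t => ∑ a, (P a).toReal *
    Real.log (∑ y, (W a y).toReal * Real.exp (t * logRatio (W a) Q y)) with hF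
  have hder : HasDerivAt F (∑ a, (P a).toReal * ∑ y, (W a y).toReal * logRatio (W a) Q y) 0 := by
    rw [hF]
    refine HasDerivAt.fun_sum fun a _ => HasDerivAt.const_mul _ ?_
    have h1 : HasDerivAt (fun t : ℝ => ∑ y, (W a y).toReal * Real.exp (t * logRatio (W a) Q y))
        (∑ y, (W a y).toReal * logRatio (W a) Q y) 0 := by
      refine HasDerivAt.fun_sum fun y _ => HasDerivAt.const_mul _ ?_
      have := ((hasDerivAt_id (0 : ℝ)).mul_const (logRatio (W a) Q y)).exp
      simpa using this
    have h2 := h1.log (by simp [pmf_sum_toReal_eq_one])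
    simpa [pmf_sum_toReal_eq_one] using h2
  have hF0 : F 0 = 0 := by simp [hF, pmf_sum_toReal_eq_one]
  have hD : ∑ a, (P a).toReal * ∑ y, (W a y).toReal * logRatio (W a) Q y < R := by
    refine lt_of_le_of_lt (le_of_eq (Finset.sum_congr rfl fun a _ => ?_)) hR
    by_cases ha : P a = 0
    · simp [ha]
    · rw [rowDiv_zero_eq (absolutelyContinuous_of_mem_inputs hP ha)]
  have hslope := (hasDerivAt_iff_tendsto_slope_zero.1 hder).mono_left
    (nhdsGT_le_nhdsNE (0 : ℝ))
  have hev := (hslope.eventually_lt_const hD).and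
    (Ioc_mem_nhdsGT (zero_lt_one' ℝ))
  obtain ⟨s, hs, hs0, hs1⟩ := hev.exists
  refine ⟨s, hs0, hs1, lt_of_le_of_lt (le_of_eq ?_) hs⟩
  rw [zero_add, hF0, sub_zero, smul_eq_mul, hF, Finset.mul_sum]
  refine Finset.sum_congr rfl fun a _ => ?_
  by_cases ha : P a = 0
  · simp [ha]
  have hac := absolutelyContinuous_of_mem_inputs hP ha
  have h1 := renyiSum_row_eq hs0 hac
  rw [renyiSum_eq_ofReal hac (by linarith), ENNReal.ofReal_eq_ofReal_iff
    (Finset.sum_nonneg fun y _ => by positivity) (Real.exp_pos _).le] at h1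
  rw [h1, Real.log_exp]
  field_simp

theorem exists_tendsto_renyiDiv_typical (hQ : (inputs W Q).Nonempty) {s : ℝ}
    (hs : s ∈ Set.Icc (-1 : ℝ) 1) {R : ℝ} (hR : rate W Q s < R) :
    ∃ P ∈ inputs W Q, ∃ ε > 0, Tendsto (fun n => renyiDiv s
      ((RandomCode.conventional (numMessages R n) (typicalLaw P ε n)).joint W)
      ((RandomCode.conventional (numMessages R n) (typicalLaw P ε n)).target Q)) atTop (𝓝 0) := by
  rcases hs.1.eq_or_lt with rfl | hs0
  · obtain ⟨P, hP⟩ := hQ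
    -- Any `ε` works, since the divergence is identically zero.
    exact ⟨P, hP, 1, one_pos, by simp only [renyiDiv_neg_one]; exact tendsto_const_nhds⟩
  obtain ⟨P, hP, hmean, -⟩ := exists_rate_eq hQ hs0.ne'
  rw [← hmean, meanDiv_eq_coe (le_max_right _ _) hP, EReal.coe_lt_coe_iff] at hR
  refine ⟨P, hP, ?_⟩
  rcases lt_or_ge 0 s with hpos | hneg
  · rw [max_eq_left hpos.le] at hR
    exact tendsto_renyiDiv_typical_of_pos hP hpos hs.2 hR
  · rw [max_eq_right hneg] at hR
    obtain ⟨t, ht0, ht1, ht⟩ := exists_sum_rowDiv_lt hP hR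
    obtain ⟨ε, hε, hlim⟩ := tendsto_renyiDiv_typical_of_pos hP ht0 ht1 ht
    refine ⟨ε, hε, tendsto_of_tendsto_of_tendsto_of_le_of_le tendsto_const_nhds hlim
      (fun n => renyiDiv_nonneg _ _ hs.1) fun n => ?_⟩
    refine le_trans ?_ (renyiDiv_zero_le _ _ ht0)
    rcases hneg.eq_or_lt with rfl | hneg
    · exact le_rfl
    · exact renyiDiv_le_zero _ _ hneg hs0

end achievability

/-! ### Converse: small divergence means closeness on events. -/

/-- Data processing for the two-letter quotient `A`, `Aᶜ`: Hölder on each of the two blocks. -/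
theorem renyiSum_le_binary {α : Type*} [Fintype α] (P Q : PMF α) {s : ℝ} (hs : s < 0)
    (hs1 : -1 < s) (A : Finset α) :
    renyiSum s P Q ≤ ENNReal.ofReal
      ((∑ a ∈ A, (P a).toReal) ^ (1 + s) * (∑ a ∈ A, (Q a).toReal) ^ (-s)
        + (1 - ∑ a ∈ A, (P a).toReal) ^ (1 + s) * (1 - ∑ a ∈ A, (Q a).toReal) ^ (-s)) := by
  classical
  have hsum : ∀ (P : PMF α) (A : Finset α), ∑ a ∈ A, P a = ENNReal.ofReal (∑ a ∈ A, (P a).toReal) :=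
    fun P A => by
      rw [← ENNReal.toReal_sum fun a _ => P.apply_ne_top a, ENNReal.ofReal_toReal]
      exact ENNReal.sum_ne_top.2 fun a _ => P.apply_ne_top a
  have hcompl : ∀ P : PMF α, 1 - ∑ a ∈ A, (P a).toReal = ∑ a ∈ Aᶜ, (P a).toReal := fun P => by
    rw [← pmf_sum_toReal_eq_one P, ← Finset.sum_add_sum_compl A]; ring
  have hnn : ∀ (P : PMF α) (A : Finset α), 0 ≤ ∑ a ∈ A, (P a).toReal := fun P A =>
    Finset.sum_nonneg fun _ _ => ENNReal.toReal_nonneg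
  rw [hcompl, hcompl, ENNReal.ofReal_add
    (mul_nonneg (Real.rpow_nonneg (hnn _ _) _) (Real.rpow_nonneg (hnn _ _) _))
    (mul_nonneg (Real.rpow_nonneg (hnn _ _) _) (Real.rpow_nonneg (hnn _ _) _)),
    ENNReal.ofReal_mul (Real.rpow_nonneg (hnn _ _) _),
    ENNReal.ofReal_mul (Real.rpow_nonneg (hnn _ _) _), renyiSum, ← Finset.sum_add_sum_compl A]
  simp only [← ENNReal.ofReal_rpow_of_nonneg (hnn _ _) (by linarith : 0 ≤ 1 + s),
    ← ENNReal.ofReal_rpow_of_nonneg (hnn _ _) (by linarith : 0 ≤ -s), ← hsum]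
  exact add_le_add (sum_rpow_mul_rpow_le P Q hs hs1 A) (sum_rpow_mul_rpow_le P Q hs hs1 Aᶜ)

/-- Two laws with a small Rényi divergence of order in `(0, 1)` are uniformly close on events. -/
theorem exists_forall_abs_sub_le {s ε : ℝ} (hs : s < 0) (hs1 : -1 < s) (hε : 0 < ε) :
    ∃ δ : ℝ, 0 < δ ∧ ∀ (α : Type v) [Fintype α] (P Q : PMF α), renyiDiv s P Q ≤ δ →
      ∀ A : Finset α, |∑ a ∈ A, (P a).toReal - ∑ a ∈ A, (Q a).toReal| ≤ ε := by
  set f : ℝ × ℝ → ℝ := fun z => z.1 ^ (1 + s) * z.2 ^ (-s) + (1 - z.1) ^ (1 + s) * (1 - z.2) ^ (-s)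
    with hf
  have hfc : Continuous f := by
    have h1 : 0 ≤ 1 + s := by linarith
    have h2 : 0 ≤ -s := by linarith
    exact ((continuous_fst.rpow_const fun _ => Or.inr h1).mul
      (continuous_snd.rpow_const fun _ => Or.inr h2)).add
      (((continuous_const.sub continuous_fst).rpow_const fun _ => Or.inr h1).mul
      ((continuous_const.sub continuous_snd).rpow_const fun _ => Or.inr h2))
  set K : Set (ℝ × ℝ) := (Set.Icc 0 1 ×ˢ Set.Icc 0 1) ∩ {z | ε ≤ |z.1 - z.2|} with hK
  have hKc : IsCompact K := (isCompact_Icc.prod isCompact_Icc).inter_right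
    (isClosed_le continuous_const (by fun_prop))
  -- Strict weighted AM-GM with weights `1 + s` and `-s`, applied to both terms; the two arithmetic
  -- means add up to `1`.
  have hlt : ∀ z ∈ K, f z < 1 := fun z hz => by
    obtain ⟨⟨⟨h1, h2⟩, h3, h4⟩, h5⟩ := hz
    have h5' : ε ≤ |z.1 - z.2| := h5
    have hne : z.1 ≠ z.2 := fun h => by rw [h, sub_self, abs_zero] at h5'; linarith
    have hw1 : 0 < 1 + s := by linarith
    have hw2 : 0 < -s := by linarith
    have e1 := (Real.geom_mean_lt_arith_mean2_weighted_iff_of_pos hw1 hw2 h1 h3 (by ring)).2 hne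
    have e2 := (Real.geom_mean_lt_arith_mean2_weighted_iff_of_pos hw1 hw2 (sub_nonneg.2 h2)
      (sub_nonneg.2 h4) (by ring)).2 fun h => hne (by linarith)
    calc f z < _ := add_lt_add e1 e2
      _ = 1 := by ring
  have hm : ∃ m < 1, ∀ z ∈ K, f z ≤ m := by
    rcases K.eq_empty_or_nonempty with h | h
    · exact ⟨0, one_pos, by simp [h]⟩
    · obtain ⟨z, hz, hmax⟩ := hKc.exists_isMaxOn h hfc.continuousOn
      exact ⟨f z, hlt z hz, fun z' hz' => hmax hz'⟩
  obtain ⟨m, hm1, hm⟩ := hm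
  -- With this `δ`, `exp (s * δ) = exp (-(1 - m) / 2)`, which is at least `(1 + m) / 2 > m`. As it
  -- depends only on `s` and `ε`, it serves all blocklengths at once.
  refine ⟨(1 - m) / (2 * -s), div_pos (by linarith) (by linarith), fun α _ P Q hD A => ?_⟩
  by_contra hcon
  rw [not_le] at hcon
  have hnn : ∀ P : PMF α, 0 ≤ ∑ a ∈ A, (P a).toReal := fun P =>
    Finset.sum_nonneg fun _ _ => ENNReal.toReal_nonneg
  have hle : ∀ P : PMF α, ∑ a ∈ A, (P a).toReal ≤ 1 := fun P => by
    rw [← pmf_sum_toReal_eq_one P]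
    exact Finset.sum_le_sum_of_subset_of_nonneg (Finset.subset_univ _)
      fun _ _ _ => ENNReal.toReal_nonneg
  have h1 := hm (∑ a ∈ A, (P a).toReal, ∑ a ∈ A, (Q a).toReal)
    ⟨⟨⟨hnn P, hle P⟩, hnn Q, hle Q⟩, hcon.le⟩
  have h2 := ((renyiDiv_le_coe_iff_of_neg hs P Q).1 hD).trans (renyiSum_le_binary P Q hs hs1 A)
  have h3 : Real.exp (s * ((1 - m) / (2 * -s))) ≤ max m 0 := by
    have := h2.trans (ENNReal.ofReal_le_ofReal (h1.trans (le_max_left m 0)))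
    rwa [ENNReal.ofReal_le_ofReal_iff (le_max_right _ _)] at this
  have h4 : s * ((1 - m) / (2 * -s)) = -((1 - m) / 2) := by
    have := hs.ne
    field_simp
  rw [h4] at h3
  rcases le_max_iff.1 h3 with h | h
  · linarith [Real.add_one_le_exp (-((1 - m) / 2))]
  · linarith [Real.exp_pos (-((1 - m) / 2))]

/-! ### Converse: codebook frequencies and the likelihood event. -/

section converse

variable {X : Type u} {Y : Type v} [Fintype Y]

/-- Some codebook of a random code is at least as good as the random code. -/
theorem exists_codebook_le {M n : ℕ} [NeZero M] (c : RandomCode X M n) (W : X → PMF Y) (Q : PMF Y)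
    {s δ : ℝ} (hs : -1 < s) (hs0 : s ≠ 0) (h : renyiDiv s (c.joint W) (c.target Q) ≤ δ) :
    ∃ u, renyiDiv s (outputLaw W (c.map u)) (piLaw fun _ => Q) ≤ δ := by
  have hne : (Finset.univ : Finset c.U).Nonempty := by
    obtain ⟨u, _⟩ := c.law.support_nonempty
    exact ⟨u, Finset.mem_univ u⟩
  rcases hs0.lt_or_gt with hneg | hpos
  · rw [renyiDiv_le_coe_iff_of_neg hneg, renyiSum_joint_target c W Q hs] at h
    obtain ⟨u, -, hu⟩ := Finset.exists_max_image Finset.univ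
      (fun u => renyiSum s (outputLaw W (c.map u)) (piLaw fun _ => Q)) hne
    refine ⟨u, (renyiDiv_le_coe_iff_of_neg hneg _ _).2 (h.trans ?_)⟩
    calc _ ≤ ∑ u', c.law u' * renyiSum s (outputLaw W (c.map u)) (piLaw fun _ => Q) :=
          Finset.sum_le_sum fun u' hu' => mul_le_mul_right (hu u' hu') _
      _ = _ := by rw [← Finset.sum_mul, pmf_sum_eq_one, one_mul]
  · rw [renyiDiv_le_coe_iff hpos, renyiSum_joint_target c W Q hs] at h
    obtain ⟨u, -, hu⟩ := Finset.exists_min_image Finset.univ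
      (fun u => renyiSum s (outputLaw W (c.map u)) (piLaw fun _ => Q)) hne
    refine ⟨u, (renyiDiv_le_coe_iff hpos _ _).2 (le_trans ?_ h)⟩
    calc _ = ∑ u', c.law u' * renyiSum s (outputLaw W (c.map u)) (piLaw fun _ => Q) := by
          rw [← Finset.sum_mul, pmf_sum_eq_one, one_mul]
      _ ≤ _ := Finset.sum_le_sum fun u' hu' => mul_le_mul_right (hu u' hu') _

open Classical in
/-- The relative frequency of a letter in a codebook. -/
def codebookFreq {M n : ℕ} (φ : Fin M → Fin n → X) (a : X) : ℝ :=
  (∑ m, ∑ i, if φ m i = a then 1 else 0) / (M * n)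

theorem sum_codebookFreq_mul [Fintype X] {M n : ℕ} (φ : Fin M → Fin n → X) (g : X → ℝ) :
    ∑ a, codebookFreq φ a * g a = (∑ m, ∑ i, g (φ m i)) / (M * n) := by
  classical
  simp only [codebookFreq, div_mul_eq_mul_div]
  rw [← Finset.sum_div]
  congr 1
  simp_rw [Finset.sum_mul]
  rw [Finset.sum_comm]
  refine Finset.sum_congr rfl fun m _ => ?_
  rw [Finset.sum_comm]
  refine Finset.sum_congr rfl fun i _ => ?_
  simp

theorem codebookFreq_mem_stdSimplex [Fintype X] {M n : ℕ} [NeZero M] (hn : 0 < n)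
    (φ : Fin M → Fin n → X) : codebookFreq φ ∈ stdSimplex ℝ X := by
  refine ⟨fun a => div_nonneg (Finset.sum_nonneg fun m _ => Finset.sum_nonneg fun i _ => ?_)
    (by positivity), ?_⟩
  · split_ifs <;> norm_num
  · have h := sum_codebookFreq_mul φ fun _ => 1
    have hM : (M : ℝ) ≠ 0 := Nat.cast_ne_zero.2 (NeZero.ne M)
    have hn' : (n : ℝ) ≠ 0 := by exact_mod_cast hn.ne'
    simp only [mul_one] at h
    have h1 : ∑ _m : Fin M, ∑ _i : Fin n, (1 : ℝ) = M * n := by simp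
    rw [h, h1, div_self (mul_ne_zero hM hn')]

theorem outputLaw_toReal {M n : ℕ} [NeZero M] (W : X → PMF Y) (φ : Fin M → Fin n → X)
    (y : Fin n → Y) :
    (outputLaw W φ y).toReal = (M : ℝ)⁻¹ * ∑ m, ∏ i, (W (φ m i) (y i)).toReal := by
  rw [outputLaw_apply, ENNReal.toReal_mul, ENNReal.toReal_inv, ENNReal.toReal_natCast,
    ENNReal.toReal_sum]
  · simp_rw [ENNReal.toReal_prod]
  · exact fun m _ => ENNReal.prod_ne_top fun i _ => PMF.apply_ne_top _ _

/-- The input frequencies of a codebook with output close to `Q ^ n` nearly induce `Q`. -/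
theorem abs_sum_codebookFreq_sub_le [Fintype X] {M n : ℕ} [NeZero M] (hn : 0 < n) (W : X → PMF Y)
    (Q : PMF Y) (φ : Fin M → Fin n → X) {ε : ℝ}
    (h : ∀ A : Finset (Fin n → Y), |∑ y ∈ A, (outputLaw W φ y).toReal
      - ∑ y ∈ A, (piLaw (fun _ => Q) y).toReal| ≤ ε) (b : Y) :
    |∑ a, codebookFreq φ a * (W a b).toReal - (Q b).toReal| ≤ ε := by
  classical
  have hn' : (0 : ℝ) < n := by exact_mod_cast hn
  have hM : (M : ℝ) ≠ 0 := Nat.cast_ne_zero.2 (NeZero.ne M)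
  have hone : ∀ (P : Fin n → PMF Y) (i : Fin n),
      ∑ y : Fin n → Y with y i = b, ∏ k, (P k (y k)).toReal = (P i b).toReal := fun P i => by
    have := sum_prod_mul_apply (fun k a => (P k a).toReal) (fun k => pmf_sum_toReal_eq_one (P k)) i
      fun a => if a = b then 1 else 0
    simp only [mul_ite, mul_one, mul_zero, Finset.sum_ite_eq', Finset.mem_univ, if_true] at this
    rw [Finset.sum_filter, this]
  have hi : ∀ i : Fin n, |(M : ℝ)⁻¹ * ∑ m, (W (φ m i) b).toReal - (Q b).toReal| ≤ ε := fun i => by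
    -- Only closeness on the events `y i = b` is used: it compares the one-letter marginals.
    have h1 := h (Finset.univ.filter fun y => y i = b)
    simp_rw [outputLaw_toReal, piLaw_toReal] at h1
    rw [← Finset.mul_sum, Finset.sum_comm, hone (fun _ => Q) i] at h1
    simpa only [hone (fun k => W (φ _ k)) i] using h1
  have havg : ∑ a, codebookFreq φ a * (W a b).toReal - (Q b).toReal
      = (∑ i : Fin n, ((M : ℝ)⁻¹ * ∑ m, (W (φ m i) b).toReal - (Q b).toReal)) / n := by
    rw [sum_codebookFreq_mul φ fun a => (W a b).toReal, Finset.sum_comm, Finset.sum_sub_distrib,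
      ← Finset.mul_sum]
    simp
    field_simp
  rw [havg, abs_div, abs_of_pos hn', div_le_iff₀ hn']
  calc _ ≤ ∑ i : Fin n, |(M : ℝ)⁻¹ * ∑ m, (W (φ m i) b).toReal - (Q b).toReal| :=
        Finset.abs_sum_le_sum_abs _ _
    _ ≤ ∑ _i : Fin n, ε := Finset.sum_le_sum fun i _ => hi i
    _ = ε * n := by simp [mul_comm]

/-- The mean log-likelihood ratio of a row of the channel. -/
def rowMean (W : X → PMF Y) (Q : PMF Y) (a : X) : ℝ :=
  ∑ b, (W a b).toReal * logRatio (W a) Q b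

/-- The variance of the log-likelihood ratio of a row of the channel. -/
def rowVar (W : X → PMF Y) (Q : PMF Y) (a : X) : ℝ :=
  ∑ b, (W a b).toReal * (logRatio (W a) Q b - rowMean W Q a) ^ 2

open Classical in
/-- The outputs whose likelihood under some codeword is at least `e ^ (n c)` times their
probability under `Q ^ n`. -/
def likelySet {M n : ℕ} (W : X → PMF Y) (Q : PMF Y) (φ : Fin M → Fin n → X) (c : ℝ) :
    Finset (Fin n → Y) :=
  Finset.univ.filter fun y => ∃ m, Real.exp (n * c) * ∏ i, (Q (y i)).toReal
    ≤ ∏ i, (W (φ m i) (y i)).toReal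

theorem sum_prod_toReal_eq_one {n : ℕ} (P : Fin n → PMF Y) :
    ∑ y : Fin n → Y, ∏ i, (P i (y i)).toReal = 1 := by
  simp_rw [← piLaw_toReal]
  exact pmf_sum_toReal_eq_one _

/-- Change of measure: on the event, `Q ^ n` is at most `exp (-(n * c))` times the sum of the `M`
codeword likelihoods, whose total mass is `M`. -/
theorem sum_likelySet_target_le {M n : ℕ} (W : X → PMF Y) (Q : PMF Y) (φ : Fin M → Fin n → X)
    (c : ℝ) : ∑ y ∈ likelySet W Q φ c, (piLaw (fun _ => Q) y).toReal ≤ M * Real.exp (-(n * c)) := by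
  calc ∑ y ∈ likelySet W Q φ c, (piLaw (fun _ => Q) y).toReal
      ≤ ∑ y ∈ likelySet W Q φ c, Real.exp (-(n * c)) * ∑ m, ∏ i, (W (φ m i) (y i)).toReal := by
        refine Finset.sum_le_sum fun y hy => ?_
        obtain ⟨m, hm⟩ := (Finset.mem_filter.1 hy).2
        rw [piLaw_toReal, Real.exp_neg, le_inv_mul_iff₀ (Real.exp_pos _)]
        exact hm.trans (Finset.single_le_sum (f := fun m => ∏ i, (W (φ m i) (y i)).toReal)
          (fun m _ => Finset.prod_nonneg fun i _ => ENNReal.toReal_nonneg) (Finset.mem_univ m))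
    _ ≤ ∑ y : Fin n → Y, Real.exp (-(n * c)) * ∑ m, ∏ i, (W (φ m i) (y i)).toReal :=
        Finset.sum_le_sum_of_subset_of_nonneg (Finset.subset_univ _) fun y _ _ =>
          mul_nonneg (Real.exp_pos _).le (Finset.sum_nonneg fun m _ =>
            Finset.prod_nonneg fun i _ => ENNReal.toReal_nonneg)
    _ = M * Real.exp (-(n * c)) := by
        rw [← Finset.mul_sum, Finset.sum_comm]
        simp_rw [sum_prod_toReal_eq_one]
        simp [mul_comm]

/-- Chebyshev for the log-likelihood ratio along one codeword: outside the event it falls short of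
its mean by at least `n * γ`. -/
theorem one_sub_le_sum_likelySet {M n : ℕ} (hn : 0 < n) (W : X → PMF Y) (Q : PMF Y)
    (φ : Fin M → Fin n → X) {c γ V : ℝ} (hγ : 0 < γ) (hV : ∀ a, rowVar W Q a ≤ V) (m : Fin M)
    (hm : n * (c + γ) ≤ ∑ i, rowMean W Q (φ m i)) :
    1 - V / (n * γ ^ 2) ≤ ∑ y ∈ likelySet W Q φ c, ∏ i, (W (φ m i) (y i)).toReal := by
  classical
  have hn' : (0 : ℝ) < n := by exact_mod_cast hn
  have hsplit : ∑ y ∈ likelySet W Q φ c, ∏ i, (W (φ m i) (y i)).toReal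
      + ∑ y ∈ (likelySet W Q φ c)ᶜ, ∏ i, (W (φ m i) (y i)).toReal = 1 := by
    rw [Finset.sum_add_sum_compl, sum_prod_toReal_eq_one]
  have hcheb := sum_prod_filter_le_of_variance (fun i b => (W (φ m i) b).toReal)
    (fun _ _ => ENNReal.toReal_nonneg) (fun i => pmf_sum_toReal_eq_one (W (φ m i)))
    (fun i b => logRatio (W (φ m i)) Q b - rowMean W Q (φ m i)) (fun i => ?_) (V := V)
    (fun i => hV (φ m i)) (t := n * γ) (by positivity)
    -- Outputs of probability zero do not change the sum but would bring in junk values of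
    -- `logRatio`. The junk value at `Q (y i) = 0` is harmless, as the factor `Q (y i)` vanishes in
    -- the comparison below.
    ((likelySet W Q φ c)ᶜ.filter fun y => ∏ i, (W (φ m i) (y i)).toReal ≠ 0) (fun y hy => ?_)
  · rw [Finset.sum_filter_ne_zero, Fintype.card_fin] at hcheb
    have : (n : ℝ) * V / (n * γ) ^ 2 = V / (n * γ ^ 2) := by field_simp
    rw [this] at hcheb
    linarith
  · simp only [mul_sub, Finset.sum_sub_distrib]
    rw [← Finset.sum_mul, pmf_sum_toReal_eq_one, one_mul, rowMean, sub_self]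
  · rw [Finset.mem_filter, Finset.mem_compl] at hy
    obtain ⟨hy1, hy2⟩ := hy
    have hy3 : ∏ i, (W (φ m i) (y i)).toReal < Real.exp (n * c) * ∏ i, (Q (y i)).toReal := by
      by_contra hcon
      exact hy1 (Finset.mem_filter.2 ⟨Finset.mem_univ y, m, not_lt.1 hcon⟩)
    have hy4 : Real.exp (∑ i, logRatio (W (φ m i)) Q (y i)) * ∏ i, (Q (y i)).toReal
        ≤ ∏ i, (W (φ m i) (y i)).toReal := by
      rw [Real.exp_sum, ← Finset.prod_mul_distrib]
      refine Finset.prod_le_prod (fun i _ => by positivity) fun i _ => ?_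
      have hw : 0 < (W (φ m i) (y i)).toReal := lt_of_le_of_ne ENNReal.toReal_nonneg
        (Finset.prod_ne_zero_iff.1 hy2 i (Finset.mem_univ i)).symm
      rcases (ENNReal.toReal_nonneg (a := Q (y i))).eq_or_lt with hq | hq
      · rw [← hq, mul_zero]; exact hw.le
      · rw [logRatio, Real.exp_log (by positivity), div_mul_cancel₀ _ hq.ne']
    have hy5 : ∑ i, logRatio (W (φ m i)) Q (y i) < n * c := by
      rw [← Real.exp_lt_exp]
      exact lt_of_mul_lt_mul_right (hy4.trans_lt hy3)
        (Finset.prod_nonneg fun i _ => ENNReal.toReal_nonneg)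
    rw [Finset.sum_sub_distrib, abs_sub_comm]
    exact le_trans (by linarith) (le_abs_self _)

/-- A reverse Markov argument. The excess of a codeword's mean over `c + γ`, divided by `B`, is at
most `1` for good codewords and at most `0` for the others, so it bounds the event probability up to
the Chebyshev error. Being linear in the mean, it averages over codewords to the codebook
frequencies. -/
theorem le_sum_likelySet_outputLaw [Fintype X] {M n : ℕ} [NeZero M] (hn : 0 < n) (W : X → PMF Y)
    (Q : PMF Y) (φ : Fin M → Fin n → X) {c γ V B : ℝ} (hγ : 0 < γ) (hV0 : 0 ≤ V)
    (hV : ∀ a, rowVar W Q a ≤ V) (hB0 : 0 < B) (hB : ∀ a, rowMean W Q a - (c + γ) ≤ B) :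
    (∑ a, codebookFreq φ a * rowMean W Q a - (c + γ)) / B - V / (n * γ ^ 2)
      ≤ ∑ y ∈ likelySet W Q φ c, (outputLaw W φ y).toReal := by
  have hn' : (0 : ℝ) < n := by exact_mod_cast hn
  have hM : (0 : ℝ) < M := Nat.cast_pos.2 (NeZero.pos M)
  have hm : ∀ m, ((∑ i, rowMean W Q (φ m i)) / n - (c + γ)) / B - V / (n * γ ^ 2)
      ≤ ∑ y ∈ likelySet W Q φ c, ∏ i, (W (φ m i) (y i)).toReal := fun m => by
    by_cases h : n * (c + γ) ≤ ∑ i, rowMean W Q (φ m i)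
    · refine le_trans ?_ (one_sub_le_sum_likelySet hn W Q φ hγ hV m h)
      have : ((∑ i, rowMean W Q (φ m i)) / n - (c + γ)) / B ≤ 1 := by
        rw [div_le_one hB0, sub_le_iff_le_add, div_le_iff₀ hn']
        calc _ ≤ ∑ _i : Fin n, (B + (c + γ)) :=
              Finset.sum_le_sum fun i _ => by linarith [hB (φ m i)]
          _ = _ := by simp; ring
      linarith
    · have h0 : 0 ≤ ∑ y ∈ likelySet W Q φ c, ∏ i, (W (φ m i) (y i)).toReal :=
        Finset.sum_nonneg fun y _ => Finset.prod_nonneg fun i _ => ENNReal.toReal_nonneg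
      refine le_trans ?_ h0
      have h1 : ((∑ i, rowMean W Q (φ m i)) / n - (c + γ)) / B ≤ 0 := by
        refine div_nonpos_of_nonpos_of_nonneg ?_ hB0.le
        rw [sub_nonpos, div_le_iff₀ hn']
        linarith
      have h2 : 0 ≤ V / (n * γ ^ 2) := by positivity
      linarith
  have hout : ∑ y ∈ likelySet W Q φ c, (outputLaw W φ y).toReal
      = (M : ℝ)⁻¹ * ∑ m, ∑ y ∈ likelySet W Q φ c, ∏ i, (W (φ m i) (y i)).toReal := by
    simp_rw [outputLaw_toReal]
    rw [← Finset.mul_sum, Finset.sum_comm]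
  rw [hout, sum_codebookFreq_mul]
  refine le_trans (le_of_eq ?_) (mul_le_mul_of_nonneg_left (Finset.sum_le_sum fun m _ => hm m)
    (inv_nonneg.2 hM.le))
  rw [Finset.sum_sub_distrib, ← Finset.sum_div, Finset.sum_sub_distrib, ← Finset.sum_div]
  simp
  field_simp

end converse

/-! ### Converse: lower bounds on the rate. -/

section converse

variable {X : Type u} {Y : Type v} [Fintype Y]

theorem sum_rpow_le_rpow_sum {ι : Type*} (t : Finset ι) (f : ι → ℝ≥0∞) {p : ℝ} (hp : 1 ≤ p) :
    ∑ i ∈ t, f i ^ p ≤ (∑ i ∈ t, f i) ^ p := by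
  classical
  induction t using Finset.induction_on with
  | empty => simp
  | insert a t ha ih =>
    rw [Finset.sum_insert ha, Finset.sum_insert ha]
    exact (add_le_add_right ih _).trans (ENNReal.add_rpow_le_rpow_add _ _ hp)

/-- By superadditivity of `x ^ (1+s)` the mixture has at least the Rényi sum of its `M` weighted
codewords taken separately; Jensen for `exp` then averages the exponents. -/
theorem exp_codebookFreq_le_renyiSum [Fintype X] {M n : ℕ} [NeZero M] (hn : 0 < n) (W : X → PMF Y)
    (Q : PMF Y) (φ : Fin M → Fin n → X) {s : ℝ} (hs : 0 < s) :
    ENNReal.ofReal ((M : ℝ)⁻¹ ^ s *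
        Real.exp (s * (n * ∑ a, codebookFreq φ a * rowDiv W Q s a)))
      ≤ renyiSum s (outputLaw W φ) (piLaw fun _ => Q) := by
  have hM : (0 : ℝ) < M := Nat.cast_pos.2 (NeZero.pos M)
  have hn' : (n : ℝ) ≠ 0 := by exact_mod_cast hn.ne'
  have hMinv : (M : ℝ≥0∞)⁻¹ = ENNReal.ofReal ((M : ℝ)⁻¹) := by
    rw [ENNReal.ofReal_inv_of_pos hM, ENNReal.ofReal_natCast]
  have hrow : ∀ m, ENNReal.ofReal (Real.exp (s * ∑ i, rowDiv W Q s (φ m i)))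
      ≤ renyiSum s (piLaw fun i => W (φ m i)) (piLaw fun _ => Q) := fun m => by
    rw [renyiSum_piLaw, Finset.mul_sum, Real.exp_sum,
      ENNReal.ofReal_prod_of_nonneg fun i _ => (Real.exp_pos _).le]
    exact Finset.prod_le_prod' fun i _ => le_renyiSum_row hs W Q (φ m i)
  have hjensen : Real.exp (s * (n * ∑ a, codebookFreq φ a * rowDiv W Q s a))
      ≤ ∑ m, (M : ℝ)⁻¹ * Real.exp (s * ∑ i, rowDiv W Q s (φ m i)) := by
    have := convexOn_exp.map_sum_le (t := (Finset.univ : Finset (Fin M))) (w := fun _ => (M : ℝ)⁻¹)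
      (p := fun m => s * ∑ i, rowDiv W Q s (φ m i)) (fun _ _ => (inv_pos.2 hM).le)
      (by simp [hM.ne']) (fun _ _ => Set.mem_univ _)
    simp only [smul_eq_mul] at this
    refine le_trans (le_of_eq (congrArg Real.exp ?_)) this
    rw [sum_codebookFreq_mul, ← Finset.mul_sum, ← Finset.mul_sum]
    field_simp
  calc _ ≤ ENNReal.ofReal ((M : ℝ)⁻¹ ^ s *
        ∑ m, (M : ℝ)⁻¹ * Real.exp (s * ∑ i, rowDiv W Q s (φ m i))) := by gcongr
    _ = ∑ m, (M : ℝ≥0∞)⁻¹ ^ (1 + s) *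
          ENNReal.ofReal (Real.exp (s * ∑ i, rowDiv W Q s (φ m i))) := by
        rw [Finset.mul_sum, ENNReal.ofReal_sum_of_nonneg fun m _ => by positivity]
        refine Finset.sum_congr rfl fun m _ => ?_
        rw [ENNReal.ofReal_mul (by positivity), ENNReal.ofReal_mul (by positivity),
          ← ENNReal.ofReal_rpow_of_pos (inv_pos.2 hM), ← hMinv, ← mul_assoc,
          ENNReal.rpow_add_of_nonneg _ _ zero_le_one hs.le, ENNReal.rpow_one, mul_comm (_ ^ s)]
    _ ≤ ∑ m, (M : ℝ≥0∞)⁻¹ ^ (1 + s) *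
          renyiSum s (piLaw fun i => W (φ m i)) (piLaw fun _ => Q) :=
        Finset.sum_le_sum fun m _ => mul_le_mul_right (hrow m) _
    _ = ∑ y, (∑ m, ((M : ℝ≥0∞)⁻¹ * ∏ i, W (φ m i) (y i)) ^ (1 + s)) *
          piLaw (fun _ => Q) y ^ (-s) := by
        simp_rw [renyiSum, Finset.mul_sum, Finset.sum_mul]
        rw [Finset.sum_comm]
        refine Finset.sum_congr rfl fun y _ => Finset.sum_congr rfl fun m _ => ?_
        rw [ENNReal.mul_rpow_of_nonneg _ _ (by linarith : 0 ≤ 1 + s), mul_assoc, piLaw_apply]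
    _ ≤ _ := by
        refine Finset.sum_le_sum fun y _ => mul_le_mul_left ?_ _
        rw [outputLaw_apply, Finset.mul_sum]
        exact sum_rpow_le_rpow_sum _ _ (by linarith)

theorem exists_code_renyiDiv_le {W : X → PMF Y} {Q : PMF Y} {s R δ : ℝ} {n : ℕ} (h : optResolvability W Q s R n < δ) :
    ∃ c : RandomCode X (numMessages R n) n, renyiDiv s (c.joint W) (c.target Q) ≤ δ := by
  obtain ⟨c, hc⟩ := iInf_lt_iff.1 h
  exact ⟨c, hc.le⟩

variable [Fintype X] {W : X → PMF Y} {Q : PMF Y}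

theorem le_of_tendsto_optResolvability_of_pos {s R r : ℝ} (hs : 0 < s) (hR : 0 < R)
    (hr : ∀ p ∈ inputSimplex W Q, r ≤ ∑ x, p x * rowDiv W Q s x)
    (hlim : Tendsto (optResolvability W Q s R) atTop (𝓝 0)) : r ≤ R := by
  by_contra hcon
  rw [not_le] at hcon
  set η := (r - R) / 2 with hη
  have hη0 : 0 < η := by linarith
  obtain ⟨ε, hε, hstab⟩ := exists_forall_sub_le_sum hη0 hr
  -- Any order parameter in `(-1, 0)` would do; monotonicity bounds it by the divergence of
  -- parameter `s`.
  obtain ⟨δ, hδ, hclose⟩ := exists_forall_abs_sub_le.{v} (s := -1 / 2) (by norm_num) (by norm_num) hε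
  have hbig : ∀ᶠ n : ℕ in atTop, δ + Real.log 2 < n * η :=
    (tendsto_natCast_atTop_atTop.atTop_mul_const hη0).eventually_gt_atTop _
  obtain ⟨n, hn1, hn2, hn⟩ := ((hlim.eventually_lt_const
    (show (0 : EReal) < (δ : EReal) by exact_mod_cast hδ)).and
    (hbig.and (eventually_gt_atTop 0))).exists
  obtain ⟨c, hc⟩ := exists_code_renyiDiv_le hn1
  obtain ⟨u, hu⟩ := exists_codebook_le c W Q (by linarith) hs.ne' hc
  have hM : (0 : ℝ) < numMessages R n := Nat.cast_pos.2 (NeZero.pos _)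
  have h1 : renyiDiv (-1 / 2) (outputLaw W (c.map u)) (piLaw fun _ => Q) ≤ δ :=
    ((renyiDiv_le_zero _ _ (by norm_num) (by norm_num)).trans (renyiDiv_zero_le _ _ hs)).trans hu
  have h2 := hstab _ (codebookFreq_mem_stdSimplex hn (c.map u))
    (abs_sum_codebookFreq_sub_le hn W Q (c.map u) (hclose _ _ _ h1))
  have h3 := (exp_codebookFreq_le_renyiSum hn W Q (c.map u) hs).trans
    ((renyiDiv_le_coe_iff hs _ _).1 hu)
  rw [ENNReal.ofReal_le_ofReal_iff (Real.exp_pos _).le, Real.rpow_def_of_pos (inv_pos.2 hM),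
    ← Real.exp_add, Real.exp_le_exp, Real.log_inv] at h3
  have h4 : Real.log (numMessages R n) ≤ Real.log 2 + n * R := by
    have := Real.log_le_log hM (numMessages_le hR n)
    rwa [Real.log_mul two_ne_zero (Real.exp_pos _).ne', Real.log_exp] at this
  have h5 : n * ∑ a, codebookFreq (c.map u) a * rowDiv W Q s a
      ≤ δ + Real.log (numMessages R n) := by
    refine le_of_mul_le_mul_left ?_ hs
    linarith
  have h6 : (n : ℝ) * (r - η) ≤ n * ∑ a, codebookFreq (c.map u) a * rowDiv W Q s a := by gcongr
  have h7 : (n : ℝ) * (r - η) = n * R + n * η := by rw [hη]; ring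
  linarith

theorem le_of_tendsto_optResolvability_of_nonpos {s R r : ℝ} (hs1 : -1 < s) (hs : s ≤ 0)
    (hR : 0 < R) (hr : ∀ p ∈ inputSimplex W Q, r ≤ ∑ x, p x * rowMean W Q x)
    (hlim : Tendsto (optResolvability W Q s R) atTop (𝓝 0)) : r ≤ R := by
  by_contra hcon
  rw [not_le] at hcon
  -- `exists_codebook_le` needs a nonzero parameter, so `s = 0` is replaced by `-1 / 2`.
  obtain ⟨t, ht, ht1, hst⟩ : ∃ t : ℝ, t < 0 ∧ -1 < t ∧
      ∀ {α : Type (max u v)} [Fintype α] (P Q : PMF α), renyiDiv t P Q ≤ renyiDiv s P Q := by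
    rcases hs.eq_or_lt with rfl | hneg
    · exact ⟨-1 / 2, by norm_num, by norm_num, fun P Q =>
        renyiDiv_le_zero P Q (by norm_num) (by norm_num)⟩
    · exact ⟨s, hneg, hs1, fun P Q => le_rfl⟩
  -- Of the gap `4 * γ`, one `γ` goes to the approximate inputs, one to the threshold `R + γ` and
  -- one to Chebyshev. The last leaves output probability about `γ / B` for the event, against an
  -- allowed discrepancy of `γ / (2 * B)`.
  set γ := (r - R) / 4 with hγ
  have hγ0 : 0 < γ := by linarith
  set B : ℝ := ∑ a, |rowMean W Q a| + 1 with hBdef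
  have hB0 : 0 < B := by positivity
  have hB : ∀ a, rowMean W Q a - (R + γ + γ) ≤ B := fun a => by
    have := Finset.single_le_sum (f := fun a => |rowMean W Q a|) (fun _ _ => abs_nonneg _)
      (Finset.mem_univ a)
    have h2 := le_abs_self (rowMean W Q a)
    linarith
  have hVnn : ∀ a, 0 ≤ rowVar W Q a := fun a =>
    Finset.sum_nonneg fun b _ => mul_nonneg ENNReal.toReal_nonneg (sq_nonneg _)
  set V : ℝ := ∑ a, rowVar W Q a
  have hV0 : 0 ≤ V := Finset.sum_nonneg fun a _ => hVnn a
  have hV : ∀ a, rowVar W Q a ≤ V := fun a =>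
    Finset.single_le_sum (fun a _ => hVnn a) (Finset.mem_univ a)
  obtain ⟨ε, hε, hstab⟩ := exists_forall_sub_le_sum hγ0 hr
  obtain ⟨δ, hδ, hclose⟩ := exists_forall_abs_sub_le.{v} ht ht1
    (lt_min hε (show 0 < γ / (2 * B) by positivity))
  have hbig : ∀ᶠ n : ℕ in atTop, V / (n * γ ^ 2) + 2 * Real.exp (-(n * γ)) < γ / (2 * B) := by
    have h1 : Tendsto (fun n : ℕ => V / (n * γ ^ 2)) atTop (𝓝 0) :=
      tendsto_const_nhds.div_atTop (tendsto_natCast_atTop_atTop.atTop_mul_const (by positivity))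
    have h2 : Tendsto (fun n : ℕ => 2 * Real.exp (-(n * γ))) atTop (𝓝 0) := by
      have : Tendsto (fun n : ℕ => Real.exp (-(n * γ))) atTop (𝓝 0) :=
        Real.tendsto_exp_neg_atTop_nhds_zero.comp
          (tendsto_natCast_atTop_atTop.atTop_mul_const hγ0)
      simpa using this.const_mul 2
    have h3 := h1.add h2
    rw [add_zero] at h3
    exact h3.eventually_lt_const (by positivity)
  obtain ⟨n, hn1, hn2, hn⟩ := ((hlim.eventually_lt_const
    (show (0 : EReal) < (δ : EReal) by exact_mod_cast hδ)).and
    (hbig.and (eventually_gt_atTop 0))).exists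
  obtain ⟨c, hc⟩ := exists_code_renyiDiv_le hn1
  obtain ⟨u, hu⟩ := exists_codebook_le c W Q ht1 ht.ne ((hst _ _).trans hc)
  have hcl := hclose _ _ _ hu
  have h2 := hstab _ (codebookFreq_mem_stdSimplex hn (c.map u))
    (abs_sum_codebookFreq_sub_le hn W Q (c.map u) fun A => (hcl A).trans (min_le_left _ _))
  have h3 := le_sum_likelySet_outputLaw hn W Q (c.map u) (c := R + γ) hγ0 hV0 hV hB0 hB
  have h4 := sum_likelySet_target_le W Q (c.map u) (R + γ)
  have h5 := (abs_le.1 ((hcl (likelySet W Q (c.map u) (R + γ))).trans (min_le_right _ _))).2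
  have h6 : (numMessages R n : ℝ) * Real.exp (-(n * (R + γ))) ≤ 2 * Real.exp (-(n * γ)) := by
    calc _ ≤ 2 * Real.exp (n * R) * Real.exp (-(n * (R + γ))) := by
          gcongr; exact numMessages_le hR n
      _ = _ := by rw [mul_assoc, ← Real.exp_add]; congr 2; ring
  have h7 : γ / B ≤ (∑ a, codebookFreq (c.map u) a * rowMean W Q a - (R + γ + γ)) / B := by
    gcongr
    linarith
  have h8 : γ / B = γ / (2 * B) + γ / (2 * B) := by field_simp; norm_num
  linarith

theorem rate_le_of_tendsto (hQ : (inputs W Q).Nonempty) {s R : ℝ} (hs : -1 ≤ s) (hR : 0 < R)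
    (hlim : Tendsto (optResolvability W Q s R) atTop (𝓝 0)) : rate W Q s ≤ R := by
  rcases hs.eq_or_lt with rfl | hs1
  · rw [rate, if_pos rfl]; exact_mod_cast hR.le
  obtain ⟨P, hP, hmean, hmin⟩ := exists_rate_eq hQ hs1.ne'
  rw [← hmean, meanDiv_eq_coe (le_max_right _ _) hP, EReal.coe_le_coe_iff]
  rcases lt_or_ge 0 s with hpos | hneg
  · rw [max_eq_left hpos.le] at hmin ⊢
    exact le_of_tendsto_optResolvability_of_pos hpos hR hmin hlim
  · rw [max_eq_right hneg] at hmin ⊢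
    refine le_of_tendsto_optResolvability_of_nonpos hs1 hneg hR (fun p hp => ?_) hlim
    -- `rowMean` and `rowDiv` may differ on rows not dominated by `Q`, but an input inducing `Q`
    -- gives these no mass.
    refine (hmin p hp).trans (le_of_eq (Finset.sum_congr rfl fun x _ => ?_))
    obtain ⟨P', hP', hPp⟩ := exists_mem_inputs hp
    rw [← hPp x]
    by_cases hx : P' x = 0
    · simp [hx]
    · rw [rowDiv_zero_eq (absolutelyContinuous_of_mem_inputs hP' hx), rowMean]

end converse

/-! ### The infimum of the achievable rates. -/

section infRate

variable {X : Type u} {Y : Type v} [Fintype X] [Fintype Y] {W : X → PMF Y} {Q : PMF Y}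

theorem infRate_le_of_forall_lt {g : ℝ → ℕ → EReal} {r : EReal} (hr : 0 ≤ r)
    (h : ∀ R : ℝ, r < R → Tendsto (g R) atTop (𝓝 0)) : infRate g ≤ r := by
  refine le_of_forall_gt_imp_ge_of_dense fun a ha => ?_
  obtain ⟨R, hR1, hR2⟩ := EReal.lt_iff_exists_real_btwn.1 ha
  have hR : 0 < R := by exact_mod_cast hr.trans_lt hR1
  have hmem : (R : EReal) ∈ {r : EReal | ∃ R : ℝ, r = R ∧ 0 < R ∧ Tendsto (g R) atTop (𝓝 0)} :=
    ⟨R, rfl, hR, h R hR1⟩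
  exact (sInf_le hmem).trans hR2.le

theorem rate_nonneg (hQ : (inputs W Q).Nonempty) {s : ℝ} : 0 ≤ rate W Q s := by
  by_cases hs : s = -1
  · rw [rate, if_pos hs]
  obtain ⟨P, hP, hmean, -⟩ := exists_rate_eq hQ hs
  rw [← hmean, meanDiv_eq_coe (le_max_right _ _) hP]
  exact_mod_cast Finset.sum_nonneg fun x _ => mul_nonneg ENNReal.toReal_nonneg
    (rowDiv_nonneg W Q (by linarith [le_max_right s 0]) x)

theorem infRate_optResolvability_eq (hQ : (inputs W Q).Nonempty) {s : ℝ}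
    (hs : s ∈ Set.Icc (-1 : ℝ) 1) : infRate (optResolvability W Q s) = rate W Q s := by
  refine le_antisymm (infRate_le_of_forall_lt (rate_nonneg hQ) fun R hR => ?_)
    (le_sInf ?_)
  · obtain ⟨P, -, ε, -, hlim⟩ := exists_tendsto_renyiDiv_typical hQ hs hR
    exact tendsto_of_tendsto_of_tendsto_of_le_of_le tendsto_const_nhds hlim
      (fun n => le_iInf fun c => renyiDiv_nonneg _ _ hs.1) fun n => iInf_le _ _
  · rintro _ ⟨R, rfl, hR, hlim⟩
    exact rate_le_of_tendsto hQ hs.1 hR hlim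

end infRate

/-! ### Order zero in the support convention. -/

section zero

variable {X : Type u} {Y : Type v} [Fintype Y] {W : X → PMF Y} {Q : PMF Y}

theorem renyiDivZero_nonneg {α : Type*} [Fintype α] (P Q : PMF α) : 0 ≤ renyiDivZero P Q := by
  classical
  rw [renyiDivZero, EReal.neg_nonneg, ENNReal.log_le_zero_iff, ← pmf_sum_eq_one Q]
  refine Finset.sum_le_sum fun a _ => ?_
  split_ifs <;> simp

theorem renyiDivZero_eq_zero {α : Type*} [Fintype α] {P Q : PMF α} (h : ∀ a, P a = 0 → Q a = 0) :
    renyiDivZero P Q = 0 := by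
  rw [renyiDivZero]
  have : ∀ a, (if P a = 0 then 0 else Q a) = Q a := fun a => by
    by_cases ha : P a = 0
    · rw [if_pos ha, h a ha]
    · rw [if_neg ha]
  simp only [this, pmf_sum_eq_one, ENNReal.log_one, neg_zero]

theorem outputLaw_eq_zero_iff {M n : ℕ} [NeZero M] {φ : Fin M → Fin n → X} {y : Fin n → Y} :
    outputLaw W φ y = 0 ↔ ∀ m, ∃ i, W (φ m i) (y i) = 0 := by
  rw [outputLaw_apply, mul_eq_zero, or_iff_right (ENNReal.inv_ne_zero.2 (ENNReal.natCast_ne_top M)),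
    Finset.sum_eq_zero_iff]
  simp [Finset.prod_eq_zero_iff]

theorem optResolvabilityZero_eq_zero {x : X} (hx : ∀ y, Q y ≠ 0 → W x y ≠ 0) (R : ℝ) (n : ℕ) :
    optResolvabilityZero W Q R n = 0 := by
  refine le_antisymm ?_ (le_iInf fun c => renyiDivZero_nonneg _ _)
  -- A deterministic code repeating the covering letter `x` for every message.
  let c : RandomCode X (numMessages R n) n :=
    { U := PUnit, law := PMF.pure PUnit.unit, map := fun _ _ _ => x }
  refine (iInf_le _ c).trans (le_of_eq (renyiDivZero_eq_zero fun p hp => ?_))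
  have h1 : c.law p.2 * outputLaw W (c.map p.2) p.1 = 0 := hp
  change piLaw (fun _ => Q) p.1 * c.law p.2 = 0
  rcases mul_eq_zero.1 h1 with h | h
  · rw [h, mul_zero]
  · obtain ⟨i, hi⟩ := outputLaw_eq_zero_iff.1 h ⟨0, NeZero.pos _⟩
    rw [piLaw_apply, Finset.prod_eq_zero (Finset.mem_univ i) (by
      by_contra hne; exact hx _ hne hi), zero_mul]

open Classical in
/-- If every row of the channel has `Q`-probability at most `β` on its support, a code with `M`
messages covers a set of `Q ^ n`-probability at most `M β ^ n`. -/
theorem sum_support_joint_le {β : ℝ≥0∞} (hβ : ∀ x, ∑ y, (if W x y = 0 then 0 else Q y) ≤ β)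
    {M n : ℕ} [NeZero M] (c : RandomCode X M n) :
    ∑ p, (if c.joint W p = 0 then 0 else c.target Q p) ≤ M * β ^ n := by
  have hφ : ∀ φ : Fin M → Fin n → X,
      ∑ y, (if outputLaw W φ y = 0 then 0 else piLaw (fun _ => Q) y) ≤ M * β ^ n := fun φ => by
    calc _ ≤ ∑ y : Fin n → Y, ∑ m, ∏ i, (if W (φ m i) (y i) = 0 then 0 else Q (y i)) := by
          refine Finset.sum_le_sum fun y _ => ?_
          split_ifs with h
          · exact zero_le
          · rw [outputLaw_eq_zero_iff] at h
            push Not at h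
            obtain ⟨m, hm⟩ := h
            refine le_trans (le_of_eq ?_) (Finset.single_le_sum (f := fun m =>
              ∏ i, (if W (φ m i) (y i) = 0 then 0 else Q (y i))) (fun _ _ => zero_le)
              (Finset.mem_univ m))
            simp only [if_neg (hm _), piLaw_apply]
      _ = ∑ m, ∏ i, ∑ b, (if W (φ m i) b = 0 then 0 else Q b) := by
          rw [Finset.sum_comm]
          exact Finset.sum_congr rfl fun m _ =>
            sum_prod_eq_prod_sum fun i b => if W (φ m i) b = 0 then 0 else Q b
      _ ≤ ∑ _m : Fin M, ∏ _i : Fin n, β :=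
          Finset.sum_le_sum fun m _ => Finset.prod_le_prod' fun i _ => hβ _
      _ = _ := by simp
  rw [Fintype.sum_prod_type_right]
  calc _ ≤ ∑ u, c.law u *
        ∑ y, (if outputLaw W (c.map u) y = 0 then 0 else piLaw (fun _ => Q) y) := by
        refine Finset.sum_le_sum fun u _ => ?_
        rw [Finset.mul_sum]
        refine Finset.sum_le_sum fun y _ => ?_
        have h1 : c.joint W (y, u) = c.law u * outputLaw W (c.map u) y := rfl
        have h2 : c.target Q (y, u) = piLaw (fun _ => Q) y * c.law u := rfl
        rw [h1, h2]
        by_cases h : outputLaw W (c.map u) y = 0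
        · simp [h]
        · rw [if_neg h, mul_comm (c.law u) (piLaw _ _)]
          split_ifs
          · exact zero_le
          · exact le_rfl
    _ ≤ ∑ u, c.law u * (M * β ^ n) := Finset.sum_le_sum fun u _ => mul_le_mul_right (hφ _) _
    _ = _ := by rw [← Finset.sum_mul, pmf_sum_eq_one, one_mul]

theorem exists_exp_bound_of_eq_zero [DecidableEq Y] [∀ x, DecidablePred fun y => W x y = 0] {x : X}
    (h : ∃ y, Q y ≠ 0 ∧ W x y = 0) :
    ∃ b : ℝ, 0 < b ∧ ∑ y, (if W x y = 0 then 0 else Q y) ≤ ENNReal.ofReal (Real.exp (-b)) := by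
  obtain ⟨y₀, h1, h2⟩ := h
  set q := ∑ y, (if W x y = 0 then 0 else Q y) with hq
  have hle : q + Q y₀ ≤ 1 := by
    rw [← pmf_sum_eq_one Q, ← Finset.sum_erase_add _ _ (Finset.mem_univ y₀), hq,
      ← Finset.sum_erase_add _ _ (Finset.mem_univ y₀), if_pos h2, add_zero]
    gcongr with y
    split_ifs <;> simp
  have hqt : q ≠ ⊤ := ne_top_of_le_ne_top ENNReal.one_ne_top (le_self_add.trans hle)
  have hlt : q < 1 := (ENNReal.lt_add_right hqt h1).trans_le hle
  have hlt' : q.toReal < 1 := by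
    rwa [← ENNReal.toReal_one, ENNReal.toReal_lt_toReal hqt ENNReal.one_ne_top]
  have hpos : 0 < max q.toReal (1 / 2) := lt_max_of_lt_right (by norm_num)
  -- The maximum with `1 / 2` keeps the logarithm negative when `q = 0`, where `Real.log` would
  -- return `0`.
  refine ⟨-Real.log (max q.toReal (1 / 2)),
    neg_pos.2 (Real.log_neg hpos (max_lt hlt' (by norm_num))), ?_⟩
  rw [neg_neg, Real.exp_log hpos]
  exact ENNReal.le_ofReal_iff_toReal_le hqt hpos.le |>.2 (le_max_left _ _)

theorem exists_pos_le_of_tendsto_zero [Fintype X] (h : ∀ x, ∃ y, Q y ≠ 0 ∧ W x y = 0) :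
    ∃ c : ℝ, 0 < c ∧ ∀ R : ℝ, 0 < R → Tendsto (optResolvabilityZero W Q R) atTop (𝓝 0) →
      c ≤ R := by
  classical
  choose b hb0 hb using fun x => exists_exp_bound_of_eq_zero (h x)
  have hsum : 0 ≤ ∑ x, (b x)⁻¹ := Finset.sum_nonneg fun x _ => (inv_pos.2 (hb0 x)).le
  -- A positive common lower bound for all `b x`.
  set c : ℝ := (∑ x, (b x)⁻¹ + 1)⁻¹ with hc
  have hc0 : 0 < c := by positivity
  have hcb : ∀ x, c ≤ b x := fun x => by
    rw [hc]
    refine inv_le_of_inv_le₀ (hb0 x) ?_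
    have := Finset.single_le_sum (f := fun x => (b x)⁻¹) (fun x _ => (inv_pos.2 (hb0 x)).le)
      (Finset.mem_univ x)
    linarith
  refine ⟨c, hc0, fun R hR hlim => ?_⟩
  by_contra hcon
  rw [not_le] at hcon
  have hbound : Tendsto (fun n : ℕ => 2 * Real.exp (-(n * (c - R)))) atTop (𝓝 0) := by
    have : Tendsto (fun n : ℕ => Real.exp (-(n * (c - R)))) atTop (𝓝 0) :=
      Real.tendsto_exp_neg_atTop_nhds_zero.comp
        (tendsto_natCast_atTop_atTop.atTop_mul_const (sub_pos.2 hcon))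
    simpa using this.const_mul 2
  -- A divergence below `1` contradicts a covered target probability of at most `exp (-1)`.
  obtain ⟨n, hn1, hn2⟩ := ((hlim.eventually_lt_const zero_lt_one).and
    (hbound.eventually_lt_const (Real.exp_pos (-1)))).exists
  obtain ⟨code, hcode⟩ := iInf_lt_iff.1 hn1
  refine hcode.not_ge ?_
  have hβ : ∀ x, ∑ y, (if W x y = 0 then 0 else Q y) ≤ ENNReal.ofReal (Real.exp (-c)) := fun x =>
    (hb x).trans (ENNReal.ofReal_le_ofReal (Real.exp_le_exp.2 (neg_le_neg (hcb x))))
  have h1 := sum_support_joint_le (fun x => by convert hβ x) code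
  have h2 : (numMessages R n : ℝ≥0∞) * ENNReal.ofReal (Real.exp (-c)) ^ n
      ≤ ENNReal.ofReal (Real.exp (-1)) := by
    rw [← ENNReal.ofReal_natCast, ← ENNReal.ofReal_pow (Real.exp_pos _).le,
      ← ENNReal.ofReal_mul (Nat.cast_nonneg _)]
    refine ENNReal.ofReal_le_ofReal (le_trans ?_ hn2.le)
    calc _ ≤ 2 * Real.exp (n * R) * Real.exp (-c) ^ n := by
          gcongr; exact numMessages_le hR n
      _ = _ := by
          rw [← Real.exp_nat_mul, mul_assoc, ← Real.exp_add]; congr 2; ring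
  rw [renyiDivZero, EReal.le_neg]
  refine (ENNReal.log_monotone (h1.trans h2)).trans (le_of_eq ?_)
  rw [ENNReal.log_ofReal_of_pos (Real.exp_pos _), Real.log_exp]
  simp

theorem infRate_optResolvabilityZero_eq_zero_iff [Fintype X] :
    infRate (optResolvabilityZero W Q) = 0 ↔ ∃ x, ∀ y, Q y ≠ 0 → W x y ≠ 0 := by
  refine ⟨fun h0 => ?_, fun ⟨x, hx⟩ => le_antisymm
    (infRate_le_of_forall_lt le_rfl fun R _ => ?_) (le_sInf ?_)⟩
  · by_contra hcon
    push Not at hcon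
    obtain ⟨c, hc, hle⟩ := exists_pos_le_of_tendsto_zero hcon
    have : (c : EReal) ≤ infRate (optResolvabilityZero W Q) := by
      refine le_sInf ?_
      rintro _ ⟨R, rfl, hR, hlim⟩
      exact_mod_cast hle R hR hlim
    rw [h0] at this
    exact absurd hc (not_lt.2 (by exact_mod_cast this))
  · exact tendsto_const_nhds.congr fun n => (optResolvabilityZero_eq_zero hx R n).symm
  · rintro _ ⟨R, rfl, hR, -⟩
    exact_mod_cast hR.le

end zero

end RenyiResolvability

end

open RenyiResolvability in
theorem theorem4 {X : Type*} {Y : Type*} [Fintype X] [Fintype Y] (W : X → PMF Y) (Q : PMF Y)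
    (hQ : (inputs W Q).Nonempty) :
    (∀ s ∈ Set.Icc (-1 : ℝ) 1,
      infRate (optResolvability W Q s) = rate W Q s ∧
      (s ≠ -1 → ∃ P ∈ inputs W Q, meanDiv W Q (max s 0) P = rate W Q s) ∧
      (∀ R : ℝ, rate W Q s < R → ∃ P ∈ inputs W Q, ∃ ε > 0,
        Tendsto (fun n => renyiDiv s
          ((RandomCode.conventional (numMessages R n) (typicalLaw P ε n)).joint W)
          ((RandomCode.conventional (numMessages R n) (typicalLaw P ε n)).target Q))
          atTop (𝓝 0))) ∧
    (infRate (optResolvabilityZero W Q) = 0 ↔ ∃ x, ∀ y, Q y ≠ 0 → W x y ≠ 0) := by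
  refine ⟨fun s hs => ⟨infRate_optResolvability_eq hQ hs, fun hs1 => ?_,
    fun R hR => exists_tendsto_renyiDiv_typical hQ hs hR⟩,
    infRate_optResolvabilityZero_eq_zero_iff⟩
  obtain ⟨P, hP, hmean, -⟩ := exists_rate_eq hQ hs1
  exact ⟨P, hP, hmean⟩
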